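/- Let $X$ be a complex Banach space. A Dirichlet series in $X$ is a formal series $D=\sum_{n\ge 1} a_n n^{-s}$ with coefficients $a_n\in X$; for $z\in\mathbb C$ put $D_z:=\sum_{n\ge1} \frac{a_n}{n^{z}}\,n^{-s}$. Let $d\omega$ be the normalized Haar measure on the infinite torus $\mathbb T^{\mathbb N}$, and let $L_\infty(\mathbb T^{\mathbb N},X)$ be the space of (classes of) essentially bounded strongly measurable functions $f:\mathbb T^{\mathbb N}\to X$ with the essential supremum norm. For a finitely supported integer sequence $\alpha\in\mathbb Z^{(\mathbb N)}$ let $\widehat f(\alpha)=\int_{\mathbb T^{\mathbb N}} f(\omega)\,\omega^{-\alpha}\,d\omega$. Let $H_\infty(\mathbb T^{\mathbb N},X)$ be the space of all $f\in L_\infty(\mathbb T^{\mathbb N},X)$ with $\widehat f(\alpha)=0$ for all $\alpha\in\mathbb Z^{(\mathbb N)}\setminus\mathbb N_0^{(\mathbb N)}$. Writing $\mathfrak p_1<\mathfrak p_2<\dots$ for the sequence of primes and $\mathfrak p^\alpha=\prod_k \mathfrak p_k^{\alpha_k}$, let $\mathcal H_\infty(X)$ be the space of all Dirichlet series $\sum_n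 a_n n^{-s}$ for which there is $f\in H_\infty(\mathbb T^{\mathbb N},X)$ with $a_{\mathfrak p^\alpha}=\widehat f(\alpha)$ for all $\alpha\in\mathbb N_0^{(\mathbb N)}$; such an $f$ is unique, and the norm of the series in $\mathcal H_\infty(X)$ is $\|f\|_\infty$. Let $\mathcal H^+_\infty(X)$ be the space of all Dirichlet series $D$ in $X$ such that $D_\varepsilon\in\mathcal H_\infty(X)$ for every $\varepsilon>0$ and $$\|D\|_{\mathcal H^+_\infty(X)}:=\sup_{\varepsilon>0}\|D_\varepsilon\|_{\mathcal H_\infty(X)}<\infty .$$ Let $\mathfrak D_\infty(X)$ be the space of all Dirichlet series $D=\sum_n a_n n^{-s}$ in $X$ that converge for every $s$ with $\operatorname{Re} s>0$ and whose sum $D(s)=\lim_{N\to\infty}\sum_{n=1}^N a_n n^{-s}$ is a bounded holomorphic function on this half-plane, with the norm $$\|D\|_{\mathfrak D_\infty(X)}:=\sup_{\operatorname{Re} s>0}\|D(s)\|_X .$$ Then $\mathcal H^+_\infty(X)=\mathfrak D_\infty(X)$ isometrically; that is, the two spaces consist of the same Dirichlet series, and $\|D\|_{\mathcal H^+_\infty(X)}=\|D\|_{\mathfrak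 D_\infty(X)}$ for every $D$ in them. -/

import Mathlib

open MeasureTheory Filter Topology
open scoped ENNReal

noncomputable section

/-- The unit circle `𝕋` carries its Borel `σ`-algebra. -/
instance circleMeasurableSpace : MeasurableSpace Circle := borel Circle

instance circleBorelSpace : BorelSpace Circle := ⟨rfl⟩

/-- The infinite-dimensional torus `𝕋^ℕ`, a compact abelian group. -/
abbrev InfTorus : Type := ℕ → Circle

/-- The normalized Haar measure `dω` on `𝕋^ℕ`. -/
def torusMeasure : Measure InfTorus :=
  Measure.haarMeasure (⊤ : TopologicalSpace.PositiveCompacts InfTorus)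

instance torusMeasure_isProbabilityMeasure : IsProbabilityMeasure torusMeasure :=
  ⟨by
    have h := Measure.haarMeasure_self (K₀ := (⊤ : TopologicalSpace.PositiveCompacts InfTorus))
    simpa [torusMeasure] using h⟩

/-- The monomial (character) `ω ↦ ω ^ α` for a finitely supported integer multi-index `α`. -/
def torusMonomial (α : ℕ →₀ ℤ) (ω : InfTorus) : ℂ :=
  α.prod fun k m => ((ω k : Circle) : ℂ) ^ m

theorem torusMonomial_continuous (α : ℕ →₀ ℤ) : Continuous (torusMonomial α) := by
  unfold torusMonomial Finsupp.prod
  refine continuous_finsetProd _ fun k _ => ?_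
  refine Continuous.zpow₀ (continuous_subtype_val.comp (continuous_apply k)) _ fun ω => Or.inl ?_
  exact Circle.coe_ne_zero _

theorem torusMonomial_norm (α : ℕ →₀ ℤ) (ω : InfTorus) : ‖torusMonomial α ω‖ = 1 := by
  simp [torusMonomial, Finsupp.prod, norm_prod, norm_zpow, Circle.norm_coe]

variable {X : Type*} [NormedAddCommGroup X] [NormedSpace ℂ X]

/-- The Fourier coefficient `f̂(α) = ∫ f(ω) ω^{-α} dω`. -/
def torusFourierCoeff (f : InfTorus → X) (α : ℕ →₀ ℤ) : X :=
  ∫ ω, torusMonomial (-α) ω • f ω ∂torusMeasure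

theorem torusFourier_integrable {p : ℝ≥0∞} [hp : Fact (1 ≤ p)] (f : Lp X p torusMeasure)
    (α : ℕ →₀ ℤ) : Integrable (fun ω => torusMonomial α ω • f ω) torusMeasure := by
  have hf : Integrable f torusMeasure := (Lp.memLp f).integrable hp.out
  exact hf.bdd_smul 1 (torusMonomial_continuous α).aestronglyMeasurable
    (Eventually.of_forall fun ω => (torusMonomial_norm α ω).le)

theorem torusFourierCoeff_zero {p : ℝ≥0∞} (α : ℕ →₀ ℤ) :
    torusFourierCoeff (0 : Lp X p torusMeasure) α = 0 := by
  unfold torusFourierCoeff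
  refine integral_eq_zero_of_ae ?_
  filter_upwards [Lp.coeFn_zero X p torusMeasure] with ω h
  rw [h, Pi.zero_apply, smul_zero]

theorem torusFourierCoeff_add {p : ℝ≥0∞} [Fact (1 ≤ p)] (f g : Lp X p torusMeasure)
    (α : ℕ →₀ ℤ) :
    torusFourierCoeff (f + g : Lp X p torusMeasure) α
      = torusFourierCoeff f α + torusFourierCoeff g α := by
  unfold torusFourierCoeff
  rw [← integral_add (torusFourier_integrable f _) (torusFourier_integrable g _)]
  refine integral_congr_ae ?_
  filter_upwards [Lp.coeFn_add f g] with ω h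
  rw [h, Pi.add_apply, smul_add]

theorem torusFourierCoeff_smul {p : ℝ≥0∞} (c : ℂ) (f : Lp X p torusMeasure)
    (α : ℕ →₀ ℤ) :
    torusFourierCoeff (c • f : Lp X p torusMeasure) α = c • torusFourierCoeff f α := by
  unfold torusFourierCoeff
  rw [← integral_smul]
  refine integral_congr_ae ?_
  filter_upwards [Lp.coeFn_smul c f] with ω h
  simp [h, smul_comm c]

variable (X) in
/-- The Hardy space `H_p(𝕋^ℕ, X)`: the functions in the Bochner space `L_p(𝕋^ℕ, X)` with
`f̂(α) = 0` for every finitely supported `α` having a negative entry. -/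
def torusHardy (p : ℝ≥0∞) [Fact (1 ≤ p)] : Submodule ℂ (Lp X p torusMeasure) where
  carrier := {f | ∀ α : ℕ →₀ ℤ, (∃ k, α k < 0) → torusFourierCoeff f α = 0}
  zero_mem' := fun α _ => torusFourierCoeff_zero α
  add_mem' := fun {f g} hf hg α hα => by
    rw [torusFourierCoeff_add, hf α hα, hg α hα, add_zero]
  smul_mem' := fun c f hf α hα => by
    rw [torusFourierCoeff_smul, hf α hα, smul_zero]

variable (X) in
/-- A formal Dirichlet series `∑ aₙ n^{-s}`, `n ≥ 1`, given by its coefficients `aₙ ∈ X`. -/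
abbrev DirSeries : Type _ := ℕ+ → X

/-- The partial sum `∑_{n=1}^N aₙ n^{-s}`. -/
def DirSeries.partialSum (D : DirSeries X) (s : ℂ) (N : ℕ) : X :=
  ∑ n ∈ Finset.range N, ((n.succPNat : ℕ+) : ℂ) ^ (-s) • D n.succPNat

/-- The sum `D(s)`: the limit of the partial sums (used only where this limit exists). -/
def DirSeries.value (D : DirSeries X) (s : ℂ) : X :=
  limUnder atTop (D.partialSum s)

/-- The translation `D_z = ∑ (aₙ / n^z) n^{-s}`. -/
def DirSeries.translate (D : DirSeries X) (z : ℂ) : DirSeries X :=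
  fun n => (n : ℂ) ^ (-z) • D n

/-- The increasing sequence `𝔭₀ < 𝔭₁ < …` of all primes. -/
def primeSeq (k : ℕ) : ℕ+ := ⟨Nat.nth Nat.Prime k, (Nat.prime_nth_prime k).pos⟩

/-- The number `𝔭^α`, the product of all `𝔭ₖ ^ αₖ`. -/
def primePow (α : ℕ →₀ ℕ) : ℕ+ :=
  α.prod fun k m => primeSeq k ^ m

/-- `D` is the Bohr transform of `f`: if `n = 𝔭^α`, then `aₙ = f̂(α)`. -/
def IsBohrTransform (f : InfTorus → X) (D : DirSeries X) : Prop :=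
  ∀ α : ℕ →₀ ℕ, D (primePow α) = torusFourierCoeff f (α.mapRange (fun m : ℕ => (m : ℤ)) rfl)

variable (X) in
/-- `𝓗_p(X)`: the image of `H_p(𝕋^ℕ, X)` under the Bohr transform. -/
def dirHardy (p : ℝ≥0∞) [Fact (1 ≤ p)] : Submodule ℂ (DirSeries X) where
  carrier := {D | ∃ f ∈ torusHardy X p, IsBohrTransform f D}
  zero_mem' := ⟨0, Submodule.zero_mem _, fun α => (torusFourierCoeff_zero _).symm⟩
  add_mem' := by
    rintro D E ⟨f, hf, hD⟩ ⟨g, hg, hE⟩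
    exact ⟨f + g, Submodule.add_mem _ hf hg, fun α => by
      rw [torusFourierCoeff_add, ← hD, ← hE, Pi.add_apply]⟩
  smul_mem' := by
    rintro c D ⟨f, hf, hD⟩
    exact ⟨c • f, Submodule.smul_mem _ c hf, fun α => by
      rw [torusFourierCoeff_smul, ← hD, Pi.smul_apply]⟩

/-- The norm of `𝓗_p(X)`, transported from `H_p(𝕋^ℕ, X)`: the `L_p`-norm of the function `f` whose
Bohr transform is `D`. As `f` is determined by its Fourier coefficients, there is at most one such
`f`, so the infimum selects its norm; it is `∞` if there is none. -/
def dirHardyNorm (p : ℝ≥0∞) [Fact (1 ≤ p)] (D : DirSeries X) : ℝ≥0∞ :=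
  ⨅ (f : Lp X p torusMeasure) (_ : f ∈ torusHardy X p) (_ : IsBohrTransform f D), ‖f‖ₑ

theorem dirHardyNorm_le {p : ℝ≥0∞} [Fact (1 ≤ p)] {D : DirSeries X} {f : Lp X p torusMeasure}
    (hf : f ∈ torusHardy X p) (hD : IsBohrTransform f D) : dirHardyNorm p D ≤ ‖f‖ₑ :=
  iInf_le_of_le f (iInf_le_of_le hf (iInf_le _ hD))

theorem dirHardyNorm_zero (p : ℝ≥0∞) [Fact (1 ≤ p)] :
    dirHardyNorm p (0 : DirSeries X) = 0 := by
  have h := dirHardyNorm_le (D := (0 : DirSeries X)) (Submodule.zero_mem (torusHardy X p))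
    (fun α => (torusFourierCoeff_zero _).symm)
  simpa using h

theorem dirHardyNorm_add_le (p : ℝ≥0∞) [Fact (1 ≤ p)] (D E : DirSeries X) :
    dirHardyNorm p (D + E) ≤ dirHardyNorm p D + dirHardyNorm p E := by
  refine le_of_forall_gt fun b hb => ?_
  obtain ⟨u, v, hu, hv, huv⟩ : ∃ u v, dirHardyNorm p D < u ∧ dirHardyNorm p E < v ∧ u + v ≤ b := by
    obtain ⟨u, hu, v, hv, h⟩ := ENNReal.exists_add_lt_of_add_lt hb
    exact ⟨u, v, hu, hv, h.le⟩
  simp only [dirHardyNorm, iInf_lt_iff] at hu hv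
  obtain ⟨f, hf, hD, hfu⟩ := hu
  obtain ⟨g, hg, hE, hgv⟩ := hv
  refine ((dirHardyNorm_le (Submodule.add_mem _ hf hg) fun α => ?_).trans
    (enorm_add_le f g)).trans_lt ((ENNReal.add_lt_add hfu hgv).trans_le huv)
  rw [torusFourierCoeff_add, ← hD, ← hE, Pi.add_apply]

theorem dirHardyNorm_smul_le (p : ℝ≥0∞) [Fact (1 ≤ p)] (c : ℂ) (D : DirSeries X) :
    dirHardyNorm p (c • D) ≤ ‖c‖ₑ * dirHardyNorm p D := by
  rcases eq_or_ne c 0 with rfl | hc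
  · simp [dirHardyNorm_zero]
  have h0 : ‖c‖ₑ ≠ 0 := by simpa using hc
  have h1 : ‖c‖ₑ ≠ ∞ := enorm_ne_top
  rw [← ENNReal.div_le_iff' h0 h1]
  refine le_iInf fun f => le_iInf fun hf => le_iInf fun hD => ?_
  rw [ENNReal.div_le_iff' h0 h1, ← enorm_smul]
  refine dirHardyNorm_le (Submodule.smul_mem _ c hf) fun α => ?_
  rw [torusFourierCoeff_smul, ← hD, Pi.smul_apply]

/-- The norm of `𝓗_p^+(X)`: `sup_{ε > 0} ‖D_ε‖_{𝓗_p(X)}`. -/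
def dirHardyPlusNorm (p : ℝ≥0∞) [Fact (1 ≤ p)] (D : DirSeries X) : ℝ≥0∞ :=
  ⨆ (ε : ℝ) (_ : 0 < ε), dirHardyNorm p (D.translate (ε : ℂ))

theorem DirSeries.translate_zero (z : ℂ) : (0 : DirSeries X).translate z = 0 := by
  funext n; simp [DirSeries.translate]

theorem DirSeries.translate_add (D E : DirSeries X) (z : ℂ) :
    (D + E).translate z = D.translate z + E.translate z := by
  funext n; simp [DirSeries.translate]

theorem DirSeries.translate_smul (c : ℂ) (D : DirSeries X) (z : ℂ) :
    (c • D).translate z = c • D.translate z := by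
  funext n; simp [DirSeries.translate, smul_comm c]

variable (X) in
/-- `𝓗_p^+(X)`: the Dirichlet series `D` with `D_ε ∈ 𝓗_p(X)` for all `ε > 0` and
`sup_{ε > 0} ‖D_ε‖_{𝓗_p(X)} < ∞`. -/
def dirHardyPlus (p : ℝ≥0∞) [Fact (1 ≤ p)] : Submodule ℂ (DirSeries X) where
  carrier := {D | (∀ ε : ℝ, 0 < ε → D.translate (ε : ℂ) ∈ dirHardy X p) ∧ dirHardyPlusNorm p D < ∞}
  zero_mem' := by
    refine ⟨fun ε _ => ?_, ?_⟩
    · rw [DirSeries.translate_zero]; exact Submodule.zero_mem _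
    · simp [dirHardyPlusNorm, DirSeries.translate_zero, dirHardyNorm_zero]
  add_mem' := by
    rintro D E ⟨hD, hD'⟩ ⟨hE, hE'⟩
    refine ⟨fun ε hε => ?_, ?_⟩
    · rw [DirSeries.translate_add]; exact Submodule.add_mem _ (hD ε hε) (hE ε hε)
    · refine lt_of_le_of_lt (iSup₂_le fun ε hε => ?_) (ENNReal.add_lt_top.2 ⟨hD', hE'⟩)
      rw [DirSeries.translate_add]
      exact (dirHardyNorm_add_le p _ _).trans (add_le_add
        (le_iSup₂ (f := fun (ε : ℝ) (_ : 0 < ε) => dirHardyNorm p (D.translate (ε : ℂ))) ε hε)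
        (le_iSup₂ (f := fun (ε : ℝ) (_ : 0 < ε) => dirHardyNorm p (E.translate (ε : ℂ))) ε hε))
  smul_mem' := by
    rintro c D ⟨hD, hD'⟩
    refine ⟨fun ε hε => ?_, ?_⟩
    · rw [DirSeries.translate_smul]; exact Submodule.smul_mem _ c (hD ε hε)
    · refine lt_of_le_of_lt (iSup₂_le fun ε hε => ?_)
        (ENNReal.mul_lt_top (enorm_lt_top (x := c)) hD')
      rw [DirSeries.translate_smul]
      exact (dirHardyNorm_smul_le p c _).trans (mul_le_mul_right
        (le_iSup₂ (f := fun (ε : ℝ) (_ : 0 < ε) => dirHardyNorm p (D.translate (ε : ℂ))) ε hε) _)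

/-- The norm of `𝔇_∞(X)`: `sup_{Re s > 0} ‖D(s)‖`. -/
def dirBoundedNorm (D : DirSeries X) : ℝ≥0∞ :=
  ⨆ (s : ℂ) (_ : 0 < s.re), ‖D.value s‖ₑ

variable (X) in
/-- `𝔇_∞(X)`: the Dirichlet series that converge at every point of the half-plane `Re s > 0` and
whose sum is a bounded holomorphic function there. -/
def dirBounded : Submodule ℂ (DirSeries X) where
  carrier := {D | ∃ F : ℂ → X, (∀ s : ℂ, 0 < s.re → Tendsto (D.partialSum s) atTop (𝓝 (F s))) ∧
    DifferentiableOn ℂ F {s : ℂ | 0 < s.re} ∧ ∃ C : ℝ, ∀ s : ℂ, 0 < s.re → ‖F s‖ ≤ C}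
  zero_mem' := by
    refine ⟨0, fun s _ => ?_, differentiableOn_const 0, 0, fun s _ => by simp⟩
    have h : (0 : DirSeries X).partialSum s = fun _ => 0 := by
      funext N; simp [DirSeries.partialSum]
    rw [h]; exact tendsto_const_nhds
  add_mem' := by
    rintro D E ⟨F, hF, hF', A, hA⟩ ⟨G, hG, hG', B, hB⟩
    refine ⟨F + G, fun s hs => ?_, hF'.add hG', A + B, fun s hs =>
      (norm_add_le _ _).trans (add_le_add (hA s hs) (hB s hs))⟩
    have h : (D + E).partialSum s = fun N => D.partialSum s N + E.partialSum s N := by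
      funext N; simp [DirSeries.partialSum, Finset.sum_add_distrib]
    rw [h]; exact (hF s hs).add (hG s hs)
  smul_mem' := by
    rintro c D ⟨F, hF, hF', A, hA⟩
    refine ⟨c • F, fun s hs => ?_, hF'.const_smul c, ‖c‖ * A, fun s hs => ?_⟩
    · have h : (c • D).partialSum s = fun N => c • D.partialSum s N := by
        funext N; simp [DirSeries.partialSum, Finset.smul_sum, smul_comm c]
      rw [h]; exact (hF s hs).const_smul c
    · rw [Pi.smul_apply, norm_smul]
      exact mul_le_mul_of_nonneg_left (hA s hs) (norm_nonneg c)

end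

noncomputable section

open MeasureTheory Filter Topology
open scoped ENNReal

variable {X : Type*} [NormedAddCommGroup X] [NormedSpace ℂ X]

/-! Through `n = 𝔭^α` a Dirichlet series becomes a power series on the torus, and `D(σ + it)` is
`D_σ` evaluated along the Kronecker flow. Both norms then measure one function, provided that the
partial sums are under control. The common currency is a Fejér bound. For a finite set `B` of
exponents the kernel `|∑_{β ∈ B} ω^β|²` is nonnegative with mean `|B|`, so convolution with it maps
a function bounded by `M` to one bounded by `M |B|`. This works with Haar measure for a Hardy
function (`FejerBound.of_isBohrTransform`) and with time averages along the flow for a Dirichlet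
polynomial (`FejerBound.of_torusFlow`). Large boxes `B` turn the bound back into a sup norm bound
for polynomials (`FejerBound.norm_torusSum_le`).

Convergence is Bohr's theorem. Averaging along the flow against an `L_1` kernel `K` multiplies `a_n`
by a Fourier coefficient of `K` at `log n`. If only finitely many multipliers survive, the result is
at most `M ‖K‖₁`: on the Hardy side by the Fejér bound (`FejerBound.kernelBound`), on the half-plane
side by analytic continuation from the region of absolute convergence (`KernelBound.of_bounded`). A
trapezoidal multiplier selects exactly `n ≤ N` at cost `O(N^δ)` (`exists_kernel`). Hence the partial
sums are `O(N^δ)` uniformly on the torus, and Abel summation makes `D_σ` converge uniformly there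
for `σ ≥ ε` (`KernelBound.exists_tail_bound`).

From Hardy space to half-plane, removing a uniformly small tail carries the Fejér bound over to the
partial sums (`FejerBound.norm_torusSum_le_add`). In the other direction the uniform limit on the
torus is the required Hardy function (`exists_torusHardy_of_tail_bound`). All kernels are scalar, so
no property of the Banach space beyond completeness enters. -/

/-! ### Prime factorization, characters of the torus and the Kronecker flow -/

theorem primePow_add (α β : ℕ →₀ ℕ) : primePow (α + β) = primePow α * primePow β :=
  Finsupp.prod_add_index' (fun _ => pow_zero _) fun _ _ _ => pow_add _ _ _

theorem primePow_zero : primePow 0 = 1 := Finsupp.prod_zero_index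

theorem primePow_single (k m : ℕ) : primePow (Finsupp.single k m) = primeSeq k ^ m :=
  Finsupp.prod_single_index (pow_zero _)

theorem factorization_primePow (α : ℕ →₀ ℕ) (k : ℕ) :
    (primePow α : ℕ).factorization (Nat.nth Nat.Prime k) = α k := by
  induction α using Finsupp.induction_linear with
  | zero => simp [primePow_zero]
  | add α β hα hβ =>
    rw [primePow_add, PNat.mul_coe, Nat.factorization_mul (PNat.ne_zero _) (PNat.ne_zero _)]
    simp [hα, hβ]
  | single j m =>
    rw [primePow_single, PNat.pow_coe, Nat.factorization_pow]
    have : ((primeSeq j : ℕ+) : ℕ) = Nat.nth Nat.Prime j := rfl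
    rw [this, (Nat.prime_nth_prime j).factorization]
    have hinj := Nat.nth_injective Nat.infinite_setOfPred_prime
    by_cases h : j = k
    · subst h; simp
    · simp [h, hinj.ne h]

theorem primePow_injective : Function.Injective primePow := fun α β h => by
  ext k
  rw [← factorization_primePow, h, factorization_primePow]

theorem primePow_surjective : Function.Surjective primePow := by
  suffices ∀ n : ℕ, ∀ h : 0 < n, ∃ α, primePow α = ⟨n, h⟩ from fun n => this n n.pos
  intro n
  induction n using Nat.recOnMul with
  | zero => intro h; exact absurd h (lt_irrefl 0)
  | one => exact fun _ => ⟨0, primePow_zero⟩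
  | prime p hp =>
    intro h
    obtain ⟨k, hk⟩ : ∃ k, Nat.nth Nat.Prime k = p :=
      (Set.ext_iff.1 (Nat.range_nth_of_infinite Nat.infinite_setOfPred_prime) p).2 hp
    refine ⟨Finsupp.single k 1, ?_⟩
    rw [primePow_single, pow_one]
    exact PNat.eq hk
  | mul a b ha hb =>
    intro h
    obtain ⟨α, hα⟩ := ha (Nat.pos_of_mul_pos_right h)
    obtain ⟨β, hβ⟩ := hb (Nat.pos_of_mul_pos_left h)
    refine ⟨α + β, ?_⟩
    rw [primePow_add, hα, hβ]
    rfl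

/-- Prime factorization of positive integers, as an equivalence with multi-indices. -/
def primeExp : ℕ+ ≃ (ℕ →₀ ℕ) :=
  (Equiv.ofBijective primePow ⟨primePow_injective, primePow_surjective⟩).symm

@[simp] theorem primePow_primeExp (n : ℕ+) : primePow (primeExp n) = n :=
  (Equiv.ofBijective primePow ⟨primePow_injective, primePow_surjective⟩).apply_symm_apply n

@[simp] theorem primeExp_primePow (α : ℕ →₀ ℕ) : primeExp (primePow α) = α :=
  (Equiv.ofBijective primePow ⟨primePow_injective, primePow_surjective⟩).symm_apply_apply α

/-- The inclusion of the nonnegative multi-indices into all multi-indices. -/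
def intIndex (α : ℕ →₀ ℕ) : ℕ →₀ ℤ := α.mapRange (fun m : ℕ => (m : ℤ)) rfl

theorem intIndex_apply (α : ℕ →₀ ℕ) (k : ℕ) : intIndex α k = α k := rfl

theorem intIndex_add (α β : ℕ →₀ ℕ) : intIndex (α + β) = intIndex α + intIndex β := by
  ext k; simp [intIndex_apply]

theorem intIndex_injective : Function.Injective intIndex := fun α β h => by
  ext k
  simpa [intIndex_apply] using DFunLike.congr_fun h k

theorem torusMonomial_zero (ω : InfTorus) : torusMonomial 0 ω = 1 := Finsupp.prod_zero_index

theorem torusMonomial_add (α β : ℕ →₀ ℤ) (ω : InfTorus) :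
    torusMonomial (α + β) ω = torusMonomial α ω * torusMonomial β ω :=
  Finsupp.prod_add_index' (fun _ => zpow_zero _)
    fun k _ _ => zpow_add₀ (Circle.coe_ne_zero (ω k)) _ _

theorem torusMonomial_ne_zero (α : ℕ →₀ ℤ) (ω : InfTorus) : torusMonomial α ω ≠ 0 := by
  rw [← norm_ne_zero_iff, torusMonomial_norm]; exact one_ne_zero

theorem torusMonomial_neg (α : ℕ →₀ ℤ) (ω : InfTorus) :
    torusMonomial (-α) ω = starRingEnd ℂ (torusMonomial α ω) := by
  have h : torusMonomial (-α) ω * torusMonomial α ω = 1 := by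
    rw [← torusMonomial_add, neg_add_cancel, torusMonomial_zero]
  refine mul_right_cancel₀ (torusMonomial_ne_zero α ω) ?_
  rw [h, mul_comm, Complex.mul_conj, Complex.normSq_eq_norm_sq, torusMonomial_norm]
  simp

theorem torusMonomial_mul (α : ℕ →₀ ℤ) (ω υ : InfTorus) :
    torusMonomial α (ω * υ) = torusMonomial α ω * torusMonomial α υ := by
  simp [torusMonomial, Finsupp.prod, mul_zpow, Finset.prod_mul_distrib]

theorem integral_torusMonomial (α : ℕ →₀ ℤ) (hα : α ≠ 0) :
    ∫ ω, torusMonomial α ω ∂torusMeasure = 0 := by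
  obtain ⟨k, hk⟩ := Finsupp.ne_iff.1 hα
  obtain ⟨z, hz⟩ : ∃ z : Circle, (z : ℂ) ^ (α k) ≠ 1 := by
    -- This angle gives `z ^ α k = -1`.
    refine ⟨Circle.exp (Real.pi / α k), ?_⟩
    have hk' : ((α k : ℤ) : ℂ) ≠ 0 := by exact_mod_cast hk
    rw [Circle.coe_exp, ← Complex.exp_int_mul]
    have : (α k : ℂ) * (((Real.pi / α k : ℝ) : ℂ) * Complex.I) = Real.pi * Complex.I := by
      push_cast; field_simp
    rw [this, Complex.exp_pi_mul_I]
    norm_num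
  let υ : InfTorus := Pi.mulSingle k z
  have hυ : torusMonomial α υ ≠ 1 := by
    have : torusMonomial α υ = (z : ℂ) ^ (α k) := by
      unfold torusMonomial Finsupp.prod
      rw [Finset.prod_eq_single k]
      · simp [υ]
      · intro j _ hj; simp [υ, Pi.mulSingle_eq_of_ne hj]
      · intro h; simp [Finsupp.notMem_support_iff.1 h]
    rwa [this]
  -- Translation by `υ` multiplies the integral by a number other than `1` and also preserves it.
  have hinv : torusMeasure.IsMulLeftInvariant := by unfold torusMeasure; infer_instance
  have h := integral_mul_left_eq_self (μ := torusMeasure) (torusMonomial α) υ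
  simp only [torusMonomial_mul, integral_const_mul] at h
  by_contra h0
  exact hυ (mul_right_cancel₀ h0 (by rw [h, one_mul]))

/-- The character of the infinite torus belonging to the positive integer `n` under the
Bohr correspondence. -/
def torusChar (n : ℕ+) (ω : InfTorus) : ℂ := torusMonomial (intIndex (primeExp n)) ω

theorem torusChar_continuous (n : ℕ+) : Continuous (torusChar n) := torusMonomial_continuous _

theorem torusChar_norm (n : ℕ+) (ω : InfTorus) : ‖torusChar n ω‖ = 1 := torusMonomial_norm _ _

theorem torusChar_mul (n : ℕ+) (ω υ : InfTorus) :
    torusChar n (ω * υ) = torusChar n ω * torusChar n υ := torusMonomial_mul _ _ _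

/-- The Kronecker flow `t ↦ (𝔭ₖ ^ {-it})ₖ` on the infinite torus. -/
def torusFlow (t : ℝ) : InfTorus := fun k => Circle.exp (-t * Real.log (primeSeq k : ℕ))

theorem torusMonomial_torusFlow (α : ℕ →₀ ℕ) (t : ℝ) :
    torusMonomial (intIndex α) (torusFlow t)
      = Complex.exp (-(t * Real.log (primePow α : ℕ) : ℝ) * Complex.I) := by
  induction α using Finsupp.induction_linear with
  | zero =>
    have : intIndex 0 = 0 := by ext; simp [intIndex_apply]
    simp [primePow_zero, this, torusMonomial_zero]
  | add α β hα hβ =>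
    rw [intIndex_add, torusMonomial_add, hα, hβ, ← Complex.exp_add, primePow_add, PNat.mul_coe,
      Nat.cast_mul, Real.log_mul (by simp) (by simp)]
    congr 1; push_cast; ring
  | single j m =>
    have : intIndex (Finsupp.single j m) = Finsupp.single j (m : ℤ) := by simp [intIndex]
    rw [this, torusMonomial, Finsupp.prod_single_index (zpow_zero _), primePow_single, PNat.pow_coe,
      Nat.cast_pow, Real.log_pow, torusFlow, Circle.coe_exp, zpow_natCast, ← Complex.exp_nat_mul]
    congr 1; push_cast; ring

theorem torusChar_torusFlow (n : ℕ+) (t : ℝ) :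
    torusChar n (torusFlow t) = (n : ℂ) ^ (-(t * Complex.I)) := by
  rw [torusChar, torusMonomial_torusFlow, primePow_primeExp,
    Complex.cpow_def_of_ne_zero (by simp), Complex.natCast_log.symm]
  congr 1; push_cast; ring

theorem torusChar_torusFlow_continuous (n : ℕ+) :
    Continuous fun t : ℝ => torusChar n (torusFlow t) := by
  simp only [torusChar, torusMonomial_torusFlow]
  fun_prop

/-- The value at `ω` of the `N`-th partial sum of `D` on the infinite torus. -/
def torusSum (D : DirSeries X) (N : ℕ) (ω : InfTorus) : X :=
  ∑ n ∈ Finset.range N, torusChar n.succPNat ω • D n.succPNat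

theorem torusSum_continuous (D : DirSeries X) (N : ℕ) : Continuous (torusSum D N) :=
  continuous_finsetSum _ fun _ _ => (torusChar_continuous _).smul continuous_const

/-- The bridge between the two sides: estimates that are uniform on the torus become estimates that
are uniform on vertical lines. -/
theorem partialSum_eq_torusSum (D : DirSeries X) (s : ℂ) (N : ℕ) :
    D.partialSum s N = torusSum (D.translate s.re) N (torusFlow s.im) := by
  refine Finset.sum_congr rfl fun n _ => ?_
  rw [torusChar_torusFlow, DirSeries.translate, smul_smul,
    ← Complex.cpow_add _ _ (Nat.cast_ne_zero.2 (PNat.ne_zero _))]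
  congr 2
  conv_lhs => rw [← Complex.re_add_im s]
  ring

/-! ### Fejér-type means -/

/-- The number of `β ∈ B` whose shift by the prime exponents of `n` stays in `B`. -/
def shiftCount (B : Finset (ℕ →₀ ℕ)) (n : ℕ+) : ℕ :=
  (B.filter fun β => primeExp n + β ∈ B).card

/-- Group the pairs by their difference: those with `β - γ = primeExp n` number `shiftCount B n`,
and differences with a negative entry contribute nothing. Since `𝔭^(β - γ)` divides `𝔭^β`, the
cutoff `N` loses no term. -/
theorem sum_torusMonomial_sub (B : Finset (ℕ →₀ ℕ)) (N : ℕ)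
    (hN : ∀ β ∈ B, (primePow β : ℕ) ≤ N) (D : DirSeries X) (L : (ℕ →₀ ℤ) → X)
    (hL : ∀ n, L (intIndex (primeExp n)) = D n) (hL' : ∀ α, (∃ k, α k < 0) → L α = 0)
    (ω : InfTorus) :
    ∑ β ∈ B, ∑ γ ∈ B, torusMonomial (intIndex β - intIndex γ) ω • L (intIndex β - intIndex γ)
      = torusSum (fun n => (shiftCount B n : ℂ) • D n) N ω := by
  have key : ∀ β ∈ B, ∀ γ ∈ B,
      torusMonomial (intIndex β - intIndex γ) ω • L (intIndex β - intIndex γ)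
        = ∑ n ∈ Finset.range N, if primeExp n.succPNat + γ = β then
            torusChar n.succPNat ω • D n.succPNat else 0 := by
    intro β hβ γ _
    by_cases h : γ ≤ β
    · obtain ⟨δ, rfl⟩ := le_iff_exists_add'.1 h
      have hle : (primePow δ : ℕ) ≤ N := by
        refine le_trans ?_ (hN _ hβ)
        rw [primePow_add, PNat.mul_coe]
        exact Nat.le_mul_of_pos_right _ (PNat.pos _)
      have hs : (PNat.natPred (primePow δ)).succPNat = primePow δ := PNat.succPNat_natPred _
      rw [Finset.sum_eq_single (PNat.natPred (primePow δ))]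
      · rw [hs, primeExp_primePow, if_pos rfl, ← hL, torusChar, primeExp_primePow, intIndex_add,
          add_sub_cancel_right]
      · intro n _ hn
        refine if_neg fun h' => hn ?_
        have := add_right_cancel h'
        rw [← this, primePow_primeExp, Nat.natPred_succPNat]
      · intro hn
        refine absurd (Finset.mem_range.2 ?_) hn
        have := PNat.natPred_add_one (primePow δ)
        omega
    · rw [hL', smul_zero, Finset.sum_eq_zero]
      · intro n _
        refine if_neg fun h' => h ?_
        rw [← h']; exact le_add_self
      · by_contra! h'
        refine h fun k => ?_
        have := h' k
        simp only [Finsupp.sub_apply, intIndex_apply] at this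
        omega
  rw [Finset.sum_congr rfl fun β hβ => Finset.sum_congr rfl (key β hβ), Finset.sum_comm,
    Finset.sum_congr rfl fun γ _ => Finset.sum_comm, Finset.sum_comm]
  refine Finset.sum_congr rfl fun n _ => ?_
  simp only [Finset.sum_ite_eq, shiftCount, Finset.card_filter, Nat.cast_sum, Nat.cast_ite,
    Nat.cast_one, Nat.cast_zero, Finset.sum_smul, Finset.smul_sum, ite_smul, one_smul, zero_smul,
    smul_ite, smul_zero]

/-- All Fejér-type means of `D` on the infinite torus are bounded by `M`. -/
def FejerBound (M : ℝ) (D : DirSeries X) : Prop :=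
  ∀ (B : Finset (ℕ →₀ ℕ)) (N : ℕ), (∀ β ∈ B, (primePow β : ℕ) ≤ N) → ∀ ω : InfTorus,
    ‖torusSum (fun n => (shiftCount B n : ℂ) • D n) N ω‖ ≤ M * B.card

/-- The left-hand sum is `∫ φ g` with `φ(u) = |∑_{β ∈ B} ω^β τ(u)^{-β}|² ≥ 0`, and the real part on
the right is `∫ φ`. An abstract space with a map `τ` to the torus covers both Haar measure and a
segment of the flow. -/
theorem norm_sum_integral_torusMonomial_le {Ω : Type*} [MeasurableSpace Ω] (μ : Measure Ω)
    [IsFiniteMeasure μ] (τ : Ω → InfTorus)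
    (hτ : ∀ α, AEStronglyMeasurable (fun u => torusMonomial α (τ u)) μ) (g : Ω → X)
    (hg : Integrable g μ) (M : ℝ) (hM : ∀ᵐ u ∂μ, ‖g u‖ ≤ M) (B : Finset (ℕ →₀ ℕ))
    (ω : InfTorus) :
    ‖∑ β ∈ B, ∑ γ ∈ B, torusMonomial (intIndex β - intIndex γ) ω •
        ∫ u, torusMonomial (-(intIndex β - intIndex γ)) (τ u) • g u ∂μ‖
      ≤ M * (∑ β ∈ B, ∑ γ ∈ B, torusMonomial (intIndex β - intIndex γ) ω *
        ∫ u, torusMonomial (-(intIndex β - intIndex γ)) (τ u) ∂μ).re := by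
  set φ : Ω → ℂ := fun u => ∑ β ∈ B, ∑ γ ∈ B, torusMonomial (intIndex β - intIndex γ) ω *
    torusMonomial (-(intIndex β - intIndex γ)) (τ u) with hφ
  have hint : ∀ α, Integrable (fun u => torusMonomial α (τ u)) μ := fun α =>
    Integrable.of_bound (hτ α) 1 (Eventually.of_forall fun u => (torusMonomial_norm _ _).le)
  have hintg : ∀ α, Integrable (fun u => torusMonomial α (τ u) • g u) μ := fun α =>
    hg.bdd_smul 1 (hτ α) (Eventually.of_forall fun u => (torusMonomial_norm _ _).le)
  have hintc : ∀ (c : ℂ) α, Integrable (fun u => c • torusMonomial α (τ u) • g u) μ :=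
    fun c α => (hintg α).smul c
  have h1 : ∑ β ∈ B, ∑ γ ∈ B, torusMonomial (intIndex β - intIndex γ) ω •
        ∫ u, torusMonomial (-(intIndex β - intIndex γ)) (τ u) • g u ∂μ = ∫ u, φ u • g u ∂μ := by
    simp only [hφ, Finset.sum_smul, mul_smul]
    rw [integral_finsetSum _ fun β _ => integrable_finsetSum _ fun γ _ => hintc _ _]
    refine Finset.sum_congr rfl fun β _ => ?_
    rw [integral_finsetSum _ fun γ _ => hintc _ _]
    exact Finset.sum_congr rfl fun γ _ => (integral_smul _ _).symm
  have hφint : Integrable φ μ :=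
    integrable_finsetSum _ fun β _ => integrable_finsetSum _ fun γ _ => (hint _).const_mul _
  have h2 : ∑ β ∈ B, ∑ γ ∈ B, torusMonomial (intIndex β - intIndex γ) ω *
        ∫ u, torusMonomial (-(intIndex β - intIndex γ)) (τ u) ∂μ = ∫ u, φ u ∂μ := by
    simp only [hφ]
    rw [integral_finsetSum _ fun β _ => integrable_finsetSum _ fun γ _ => (hint _).const_mul _]
    refine Finset.sum_congr rfl fun β _ => ?_
    rw [integral_finsetSum _ fun γ _ => (hint _).const_mul _]
    exact Finset.sum_congr rfl fun γ _ => (integral_const_mul _ _).symm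
  have h3 : ∀ u, φ u = (‖φ u‖ : ℂ) := by
    intro u
    have : φ u = (∑ β ∈ B, torusMonomial (intIndex β) ω * torusMonomial (-intIndex β) (τ u)) *
        starRingEnd ℂ (∑ β ∈ B, torusMonomial (intIndex β) ω *
          torusMonomial (-intIndex β) (τ u)) := by
      simp only [hφ, map_sum, map_mul, ← torusMonomial_neg, neg_neg, Finset.sum_mul_sum]
      refine Finset.sum_congr rfl fun β _ => Finset.sum_congr rfl fun γ _ => ?_
      rw [sub_eq_add_neg, torusMonomial_add, neg_add, torusMonomial_add, neg_neg]
      ring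
    rw [this, Complex.mul_conj, Complex.normSq_eq_norm_sq]
    simp
  rw [h1, h2, integral_congr_ae (Eventually.of_forall h3), integral_complex_ofReal,
    Complex.ofReal_re, ← integral_const_mul]
  refine norm_integral_le_of_norm_le (hφint.norm.const_mul M) ?_
  filter_upwards [hM] with u hu
  rw [norm_smul, mul_comm M]
  gcongr

theorem ae_norm_coeFn_le {E Ω : Type*} [NormedAddCommGroup E] [MeasurableSpace Ω]
    {μ : Measure Ω} (f : Lp E ∞ μ) :
    ∀ᵐ u ∂μ, ‖f u‖ ≤ ‖f‖ := by
  filter_upwards [ae_le_eLpNormEssSup (f := f) (μ := μ)] with u hu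
  rw [← eLpNorm_exponent_top] at hu
  rw [Lp.norm_def, ← toReal_enorm]
  exact ENNReal.toReal_mono (Lp.eLpNorm_ne_top f) hu

theorem FejerBound.of_isBohrTransform {f : Lp X ∞ torusMeasure} (hf : f ∈ torusHardy X ∞)
    {D : DirSeries X} (hD : IsBohrTransform f D) : FejerBound ‖f‖ D := by
  intro B N hN ω
  have hmul : ∀ α, AEStronglyMeasurable (fun u : InfTorus => torusMonomial α u) torusMeasure :=
    fun α => (torusMonomial_continuous α).aestronglyMeasurable
  have h := norm_sum_integral_torusMonomial_le torusMeasure id hmul f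
    ((Lp.memLp f).integrable le_top) ‖f‖ (ae_norm_coeFn_le f) B ω
  have hL : ∀ n, torusFourierCoeff f (intIndex (primeExp n)) = D n := fun n => by
    have := hD (primeExp n)
    rw [primePow_primeExp] at this
    exact this.symm
  simp only [id] at h
  rw [← sum_torusMonomial_sub B N hN D (torusFourierCoeff f) hL hf ω]
  refine h.trans_eq ?_
  congr 1
  -- By orthogonality of characters only the diagonal survives, so the kernel has total mass `|B|`.
  have : ∀ β ∈ B, ∑ γ ∈ B, torusMonomial (intIndex β - intIndex γ) ω *
      ∫ u, torusMonomial (-(intIndex β - intIndex γ)) u ∂torusMeasure = 1 := by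
    intro β hβ
    rw [Finset.sum_eq_single β]
    · simp [torusMonomial_zero]
    · intro γ _ hγ
      rw [integral_torusMonomial, mul_zero]
      rw [neg_ne_zero, sub_ne_zero]
      exact fun h => hγ (intIndex_injective h).symm
    · exact fun h => absurd hβ h
  rw [Finset.sum_congr rfl this]
  simp

/-! ### Time averages along the flow -/

theorem exists_intIndex_sub (α : ℕ →₀ ℤ) : ∃ β γ, α = intIndex β - intIndex γ := by
  refine ⟨α.mapRange Int.toNat rfl, (-α).mapRange Int.toNat rfl, ?_⟩
  ext k
  simp only [Finsupp.sub_apply, intIndex_apply, Finsupp.mapRange_apply, Finsupp.neg_apply]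
  omega

theorem torusMonomial_sub_torusFlow (β γ : ℕ →₀ ℕ) (t : ℝ) :
    torusMonomial (intIndex β - intIndex γ) (torusFlow t)
      = Complex.exp (((Real.log (primePow γ : ℕ) - Real.log (primePow β : ℕ) : ℝ) * Complex.I)
          * t) := by
  rw [sub_eq_add_neg, torusMonomial_add, torusMonomial_neg, torusMonomial_torusFlow,
    torusMonomial_torusFlow, ← Complex.exp_conj, ← Complex.exp_add]
  congr 1
  simp only [map_mul, map_neg, Complex.conj_ofReal, Complex.conj_I]
  push_cast; ring

theorem torusMonomial_torusFlow_continuous (α : ℕ →₀ ℤ) :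
    Continuous fun t : ℝ => torusMonomial α (torusFlow t) := by
  obtain ⟨β, γ, rfl⟩ := exists_intIndex_sub α
  simp only [torusMonomial_sub_torusFlow]
  fun_prop

/-- Along the flow a nontrivial character is `e^{iθt}` with `θ ≠ 0` by unique factorization, so its
integral stays bounded by `2 / |θ|`. Time averages thus reproduce the orthogonality relations of
Haar measure. -/
theorem tendsto_mean_torusMonomial (α : ℕ →₀ ℤ) :
    Tendsto (fun R : ℝ => (R : ℂ)⁻¹ * ∫ t in (0 : ℝ)..R, torusMonomial α (torusFlow t)) atTop
      (𝓝 (if α = 0 then 1 else 0)) := by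
  split_ifs with h
  · subst h
    refine tendsto_const_nhds.congr' ?_
    filter_upwards [eventually_gt_atTop 0] with R hR
    have : (R : ℂ) ≠ 0 := by exact_mod_cast hR.ne'
    simp [torusMonomial_zero, this]
  · obtain ⟨β, γ, rfl⟩ := exists_intIndex_sub α
    set θ : ℝ := Real.log (primePow γ : ℕ) - Real.log (primePow β : ℕ) with hθ
    have hθ0 : θ ≠ 0 := by
      intro h0
      have h1 : ((primePow γ : ℕ) : ℝ) = (primePow β : ℕ) :=
        Real.log_injOn_pos (Set.mem_Ioi.2 (by simp)) (Set.mem_Ioi.2 (by simp)) (sub_eq_zero.1 h0)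
      have h2 := primePow_injective (PNat.eq (Nat.cast_injective h1))
      exact h (by rw [h2, sub_self])
    have hc : (θ : ℂ) * Complex.I ≠ 0 := by simp [hθ0]
    have hlim : Tendsto (fun R : ℝ => |R|⁻¹ * (2 / |θ|)) atTop (𝓝 0) := by
      simpa using (tendsto_inv_atTop_zero.comp tendsto_abs_atTop_atTop).mul_const (2 / |θ|)
    refine squeeze_zero_norm (fun R => ?_) hlim
    simp only [torusMonomial_sub_torusFlow]
    rw [integral_exp_mul_complex hc, norm_mul, norm_inv, Complex.norm_real, Real.norm_eq_abs,
      norm_div, norm_mul, Complex.norm_I, mul_one, Complex.norm_real, Real.norm_eq_abs]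
    gcongr
    refine (norm_sub_le _ _).trans ?_
    have : ∀ t : ℝ, ‖Complex.exp ((θ : ℂ) * Complex.I * t)‖ = 1 := fun t => by
      rw [show (θ : ℂ) * Complex.I * t = ((θ * t : ℝ) : ℂ) * Complex.I by push_cast; ring,
        Complex.norm_exp_ofReal_mul_I]
    rw [this, this]; norm_num

theorem FejerBound.of_torusFlow [CompleteSpace X] {M : ℝ} {D : DirSeries X} {N₀ : ℕ}
    (hD : ∀ n, N₀ ≤ n → D n.succPNat = 0) (hM : ∀ t, ‖torusSum D N₀ (torusFlow t)‖ ≤ M) :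
    FejerBound M D := by
  classical
  intro B N hN ω
  -- `L` is the family of Fourier coefficients of the polynomial, obtained here as limits of time
  -- averages.
  set L : (ℕ →₀ ℤ) → X := fun α => ∑ n ∈ Finset.range N₀,
    (if intIndex (primeExp n.succPNat) - α = 0 then (1 : ℂ) else 0) • D n.succPNat with hL
  have hmean : ∀ α, Tendsto (fun R : ℝ => (R : ℂ)⁻¹ • ∫ t in (0 : ℝ)..R,
      torusMonomial (-α) (torusFlow t) • torusSum D N₀ (torusFlow t)) atTop (𝓝 (L α)) := by
    intro α
    have : ∀ R : ℝ, (R : ℂ)⁻¹ • ∫ t in (0 : ℝ)..R,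
        torusMonomial (-α) (torusFlow t) • torusSum D N₀ (torusFlow t)
        = ∑ n ∈ Finset.range N₀, ((R : ℂ)⁻¹ * ∫ t in (0 : ℝ)..R,
          torusMonomial (intIndex (primeExp n.succPNat) - α) (torusFlow t)) • D n.succPNat := by
      intro R
      have hint : ∀ (n : ℕ), IntervalIntegrable (fun t : ℝ => torusMonomial
          (-α + intIndex (primeExp n.succPNat)) (torusFlow t) • D n.succPNat) volume 0 R := fun n =>
        ((torusMonomial_torusFlow_continuous _).smul continuous_const).intervalIntegrable _ _
      simp only [torusSum, Finset.smul_sum, smul_smul, torusChar, ← torusMonomial_add]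
      rw [intervalIntegral.integral_finsetSum fun n _ => hint n, Finset.smul_sum]
      refine Finset.sum_congr rfl fun n _ => ?_
      rw [intervalIntegral.integral_smul_const, smul_smul, neg_add_eq_sub]
    simp only [this]
    exact tendsto_finsetSum _ fun n _ => (tendsto_mean_torusMonomial _).smul_const _
  rw [← sum_torusMonomial_sub B N hN D L ?_ ?_ ω]
  · have h1 : Tendsto (fun R : ℝ => ∑ β ∈ B, ∑ γ ∈ B,
        torusMonomial (intIndex β - intIndex γ) ω • (R : ℂ)⁻¹ • ∫ t in (0 : ℝ)..R,
          torusMonomial (-(intIndex β - intIndex γ)) (torusFlow t) •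
            torusSum D N₀ (torusFlow t)) atTop (𝓝 (∑ β ∈ B, ∑ γ ∈ B,
        torusMonomial (intIndex β - intIndex γ) ω • L (intIndex β - intIndex γ))) :=
      tendsto_finsetSum _ fun β _ => tendsto_finsetSum _ fun γ _ => (hmean _).const_smul _
    have h2 : Tendsto (fun R : ℝ => M * (∑ β ∈ B, ∑ γ ∈ B,
        torusMonomial (intIndex β - intIndex γ) ω * ((R : ℂ)⁻¹ * ∫ t in (0 : ℝ)..R,
          torusMonomial (-(intIndex β - intIndex γ)) (torusFlow t))).re) atTop
        (𝓝 (M * (∑ β ∈ B, ∑ γ ∈ B, torusMonomial (intIndex β - intIndex γ) ω *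
          (if -(intIndex β - intIndex γ) = 0 then (1 : ℂ) else 0)).re)) :=
      ((Complex.continuous_re.tendsto _).comp (tendsto_finsetSum _ fun β _ =>
        tendsto_finsetSum _ fun γ _ => (tendsto_mean_torusMonomial _).const_mul _)).const_mul M
    have h3 : ∑ β ∈ B, ∑ γ ∈ B, torusMonomial (intIndex β - intIndex γ) ω *
          (if -(intIndex β - intIndex γ) = 0 then (1 : ℂ) else 0) = B.card := by
      have : ∀ β ∈ B, ∑ γ ∈ B, torusMonomial (intIndex β - intIndex γ) ω *
          (if -(intIndex β - intIndex γ) = 0 then (1 : ℂ) else 0) = 1 := by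
        intro β hβ
        rw [Finset.sum_eq_single β]
        · simp [torusMonomial_zero]
        · intro γ _ hγ
          rw [if_neg, mul_zero]
          rw [neg_eq_zero, sub_eq_zero]
          exact fun h => hγ (intIndex_injective h).symm
        · exact fun h => absurd hβ h
      rw [Finset.sum_congr rfl this]
      simp
    rw [h3, Complex.natCast_re] at h2
    -- The positive-kernel estimate holds on each segment `[0, R]`; its mass, divided by `R`, tends
    -- to `|B|`.
    refine le_of_tendsto_of_tendsto h1.norm h2 ?_
    filter_upwards [eventually_gt_atTop 0] with R hR
    have hcont : Continuous fun t => torusSum D N₀ (torusFlow t) :=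
      continuous_finsetSum _ fun _ _ => (torusChar_torusFlow_continuous _).smul continuous_const
    have h := norm_sum_integral_torusMonomial_le (volume.restrict (Set.Ioc 0 R)) torusFlow
      (fun α => (torusMonomial_torusFlow_continuous α).aestronglyMeasurable)
      (fun t => torusSum D N₀ (torusFlow t))
      (Integrable.of_bound hcont.aestronglyMeasurable M (Eventually.of_forall hM)) M
      (Eventually.of_forall hM) B ω
    simp only [intervalIntegral.integral_of_le hR.le]
    simp only [smul_comm _ (R : ℂ)⁻¹, mul_left_comm _ (R : ℂ)⁻¹, ← Finset.smul_sum,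
      ← Finset.mul_sum]
    rw [norm_smul, ← Complex.ofReal_inv, Complex.re_ofReal_mul, Complex.norm_real,
      Real.norm_of_nonneg (by positivity), mul_left_comm]
    gcongr
  · intro n
    simp only [hL, sub_eq_zero, intIndex_injective.eq_iff, primeExp.injective.eq_iff, ite_smul,
      one_smul, zero_smul]
    by_cases hn : n.natPred < N₀
    · rw [Finset.sum_eq_single n.natPred]
      · simp
      · intro m _ hm
        refine if_neg fun h => hm ?_
        rw [← h, Nat.natPred_succPNat]
      · exact fun h => absurd (Finset.mem_range.2 hn) h
    · have := hD _ (not_lt.1 hn)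
      rw [PNat.succPNat_natPred] at this
      rw [this]
      refine Finset.sum_eq_zero fun m _ => ?_
      split_ifs with h
      · rw [h, this]
      · rfl
  · rintro α ⟨k, hk⟩
    refine Finset.sum_eq_zero fun n _ => ?_
    rw [if_neg, zero_smul]
    intro h
    have := DFunLike.congr_fun (sub_eq_zero.1 h) k
    rw [intIndex_apply] at this
    omega

/-! ### Large boxes and Kronecker's theorem -/

theorem tendsto_card_Iic_ratio (γ : ℕ →₀ ℕ) :
    Tendsto (fun m : ℕ => ((Finset.Iic (m • γ)).card : ℝ) / (Finset.Iic ((m + 1) • γ)).card)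
      atTop (𝓝 1) := by
  have hcard : ∀ m : ℕ, ((Finset.Iic (m • γ)).card : ℝ) = ∏ i ∈ γ.support, ((m : ℝ) * γ i + 1) := by
    intro m
    rw [Finsupp.card_Iic, Finset.prod_subset (Finsupp.support_smul (b := m) (g := γ))]
    · simp
    · intro i _ hi
      rw [Finsupp.notMem_support_iff.1 hi]; rfl
  simp only [hcard, ← Finset.prod_div_distrib]
  suffices h : ∀ i, Tendsto (fun m : ℕ => ((m : ℝ) * γ i + 1) / (((m + 1 : ℕ) : ℝ) * γ i + 1))
      atTop (𝓝 1) by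
    simpa using tendsto_finsetProd γ.support fun i _ => h i
  intro i
  have h1 : Tendsto (fun m : ℕ => 1 - 1 / ((m : ℝ) + 1)) atTop (𝓝 1) := by
    simpa using tendsto_const_nhds.sub (tendsto_one_div_add_atTop_nhds_zero_nat (𝕜 := ℝ))
  refine tendsto_of_tendsto_of_tendsto_of_le_of_le h1 tendsto_const_nhds (fun m => ?_) fun m => ?_
  · push_cast
    rw [le_div_iff₀ (by positivity)]
    have : (1 - 1 / ((m : ℝ) + 1)) * ((m + 1) * γ i + 1) = m * γ i + 1 - 1 / (m + 1) := by
      field_simp; ring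
    rw [this]
    have : 0 ≤ 1 / ((m : ℝ) + 1) := by positivity
    linarith
  · push_cast
    rw [div_le_one (by positivity)]
    nlinarith [(γ i).cast_nonneg (α := ℝ)]

/-- Shifting by `primeExp n ≤ γ` keeps the subbox below `m • γ` inside the box below `(m + 1) • γ`,
and the two boxes have asymptotically equal cardinality: a Følner property. -/
theorem tendsto_shiftCount_ratio {γ : ℕ →₀ ℕ} {n : ℕ+} (hn : primeExp n ≤ γ) :
    Tendsto (fun m : ℕ => (shiftCount (Finset.Iic ((m + 1) • γ)) n : ℝ) /
      (Finset.Iic ((m + 1) • γ)).card) atTop (𝓝 1) := by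
  refine tendsto_of_tendsto_of_tendsto_of_le_of_le (tendsto_card_Iic_ratio γ) tendsto_const_nhds
    (fun m => ?_) fun m => ?_
  · simp only
    gcongr
    refine Finset.card_le_card fun β hβ => ?_
    rw [Finset.mem_Iic] at hβ
    rw [Finset.mem_filter, Finset.mem_Iic, Finset.mem_Iic, add_smul, one_smul]
    exact ⟨hβ.trans le_self_add, add_comm (m • γ) γ ▸ add_le_add hn hβ⟩
  · refine div_le_one_of_le₀ ?_ (by positivity)
    exact Nat.cast_le.2 (Finset.card_filter_le _ _)

theorem torusSum_eq_of_le {D : DirSeries X} {N N' : ℕ} (hD : ∀ n, N ≤ n → D n.succPNat = 0)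
    (h : N ≤ N') (ω : InfTorus) : torusSum D N' ω = torusSum D N ω := by
  refine (Finset.sum_subset (Finset.range_mono h) fun n _ hn => ?_).symm
  rw [hD n (not_lt.1 fun h' => hn (Finset.mem_range.2 h')), smul_zero]

/-- After division by `|B|` the weights of the finitely many coefficients tend to `1` along growing
boxes, so the Fejér means converge to the polynomial itself. -/
theorem FejerBound.norm_torusSum_le {M : ℝ} {D : DirSeries X} (h : FejerBound M D) {N : ℕ}
    (hD : ∀ n, N ≤ n → D n.succPNat = 0) (ω : InfTorus) : ‖torusSum D N ω‖ ≤ M := by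
  -- The sum dominates every exponent that occurs in the polynomial.
  set γ : ℕ →₀ ℕ := ∑ n ∈ Finset.range N, primeExp n.succPNat
  set B : ℕ → Finset (ℕ →₀ ℕ) := fun m => Finset.Iic ((m + 1) • γ)
  have hB : ∀ m, 0 < (B m).card := fun m => Finset.card_pos.2 ⟨0, Finset.mem_Iic.2 (bot_le)⟩
  have hlim : Tendsto (fun m => torusSum (fun n =>
      (((shiftCount (B m) n : ℝ) / (B m).card : ℝ) : ℂ) • D n) N ω) atTop (𝓝 (torusSum D N ω)) := by
    refine tendsto_finsetSum _ fun n hn => Tendsto.const_smul ?_ _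
    have hle : primeExp n.succPNat ≤ γ :=
      Finset.single_le_sum (f := fun n : ℕ => primeExp n.succPNat) (fun _ _ => bot_le) hn
    simpa using ((Complex.continuous_ofReal.tendsto _).comp
      (tendsto_shiftCount_ratio hle)).smul_const (D n.succPNat)
  refine le_of_tendsto hlim.norm (Eventually.of_forall fun m => ?_)
  have hb := h (B m) (max N ((B m).sup fun β => (primePow β : ℕ)))
    (fun β hβ => (Finset.le_sup (f := fun β => (primePow β : ℕ)) hβ).trans (le_max_right _ _)) ω
  rw [torusSum_eq_of_le (fun n hn => by rw [hD n hn, smul_zero]) (le_max_left _ _)] at hb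
  have : torusSum (fun n => (((shiftCount (B m) n : ℝ) / (B m).card : ℝ) : ℂ) • D n) N ω
      = ((B m).card : ℂ)⁻¹ • torusSum (fun n => (shiftCount (B m) n : ℂ) • D n) N ω := by
    rw [torusSum, torusSum, Finset.smul_sum]
    refine Finset.sum_congr rfl fun n _ => ?_
    rw [smul_comm _ (torusChar _ _), smul_smul ((B m).card : ℂ)⁻¹]
    congr 2; push_cast; ring
  rw [this, norm_smul, norm_inv, Complex.norm_natCast, inv_mul_le_iff₀ (by exact_mod_cast hB m)]
  rwa [mul_comm]

/-- Kronecker's approximation theorem: a Dirichlet polynomial is as large on the image of the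
vertical flow as on the whole infinite torus. -/
theorem norm_torusSum_le_of_torusFlow [CompleteSpace X] {M : ℝ} (D : DirSeries X) (N : ℕ)
    (hM : ∀ t, ‖torusSum D N (torusFlow t)‖ ≤ M) (ω : InfTorus) : ‖torusSum D N ω‖ ≤ M := by
  set E : DirSeries X := fun n => if n.natPred < N then D n else 0
  have hE : ∀ n, N ≤ n → E n.succPNat = 0 := fun n hn => if_neg (by simpa using hn)
  have hs : torusSum D N = torusSum E N := by
    funext ω
    refine Finset.sum_congr rfl fun n hn => ?_
    simp [E, Finset.mem_range.1 hn]
  rw [hs] at hM ⊢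
  exact (FejerBound.of_torusFlow hE hM).norm_torusSum_le hE ω

/-! ### Kernel means along the flow -/

/-- The Fourier coefficient `∫ n ^ {2πiw} K(w) dw` of a kernel at the frequency `log n`. -/
def kernelCoeff (K : ℝ → ℂ) (n : ℕ+) : ℂ :=
  ∫ w, torusChar n (torusFlow (-(2 * Real.pi * w))) * K w

theorem torusChar_kernel_integrable {K : ℝ → ℂ} (hK : Integrable K) (n : ℕ+) :
    Integrable fun w => torusChar n (torusFlow (-(2 * Real.pi * w))) * K w := by
  refine hK.bdd_mul (c := 1) ?_ (Eventually.of_forall fun w => (torusChar_norm _ _).le)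
  exact ((torusChar_torusFlow_continuous n).comp (by fun_prop :
    Continuous fun w : ℝ => -(2 * Real.pi * w))).aestronglyMeasurable

/-- The kernel means of `D` with finitely many frequencies are bounded by `M` times the `L_1`-norm
of the kernel. -/
def KernelBound (M : ℝ) (D : DirSeries X) : Prop :=
  ∀ (K : ℝ → ℂ) (N : ℕ), Integrable K → (∀ n, N ≤ n → kernelCoeff K n.succPNat = 0) →
    ∀ ω, ‖torusSum (fun n => kernelCoeff K n • D n) N ω‖ ≤ M * ∫ w, ‖K w‖

theorem torusSum_kernelCoeff [CompleteSpace X] {K : ℝ → ℂ} (hK : Integrable K) (D : DirSeries X)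
    (N : ℕ) (ω : InfTorus) : torusSum (fun n => kernelCoeff K n • D n) N ω
      = ∫ w, K w • torusSum D N (ω * torusFlow (-(2 * Real.pi * w))) := by
  have h : ∀ n ∈ Finset.range N, Integrable fun w : ℝ =>
      (torusChar n.succPNat (torusFlow (-(2 * Real.pi * w))) * K w) •
        torusChar n.succPNat ω • D n.succPNat :=
    fun n _ => (torusChar_kernel_integrable hK _).smul_const _
  have h2 : ∀ w, K w • torusSum D N (ω * torusFlow (-(2 * Real.pi * w)))
      = ∑ n ∈ Finset.range N, (torusChar n.succPNat (torusFlow (-(2 * Real.pi * w))) * K w) •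
        torusChar n.succPNat ω • D n.succPNat := by
    intro w
    rw [torusSum, Finset.smul_sum]
    refine Finset.sum_congr rfl fun n _ => ?_
    rw [torusChar_mul, smul_smul, smul_smul]
    congr 1; ring
  simp only [h2]
  rw [integral_finsetSum _ h]
  refine Finset.sum_congr rfl fun n _ => ?_
  rw [integral_smul_const, smul_comm, kernelCoeff]

/-- Fejér means commute with averaging over translates, so the Fejér bound passes to the kernel mean
with the factor `‖K‖₁`. The mean is a polynomial, for which the Fejér bound is a sup norm bound. -/
theorem FejerBound.kernelBound [CompleteSpace X] {M : ℝ} {D : DirSeries X} (h : FejerBound M D) :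
    KernelBound M D := by
  intro K N hK hN ω
  refine FejerBound.norm_torusSum_le (M := M * ∫ w, ‖K w‖) ?_
    (fun n hn => by rw [hN n hn, zero_smul]) ω
  intro B N' hN' υ
  have := torusSum_kernelCoeff hK (fun n => (shiftCount B n : ℂ) • D n) N' υ
  simp only [smul_comm (kernelCoeff K _)] at this
  rw [this, mul_right_comm, ← integral_const_mul]
  refine norm_integral_le_of_norm_le (hK.norm.const_mul _) (Eventually.of_forall fun w => ?_)
  rw [norm_smul, mul_comm]
  gcongr
  exact h B N' hN' _

theorem norm_natCast_cpow_neg (n : ℕ+) (s : ℂ) : ‖(n : ℂ) ^ (-s)‖ = (n : ℝ) ^ (-s.re) := by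
  rw [Complex.norm_natCast_cpow_of_pos n.pos, Complex.neg_re]

theorem exists_norm_le_mul_of_tendsto {D : DirSeries X} {x : X}
    (h : Tendsto (D.partialSum 1) atTop (𝓝 x)) : ∃ C : ℝ, ∀ n : ℕ+, ‖D n‖ ≤ C * n := by
  have h1 : Tendsto (fun N => D.partialSum 1 (N + 1) - D.partialSum 1 N) atTop (𝓝 (x - x)) :=
    ((tendsto_add_atTop_iff_nat 1).2 h).sub h
  obtain ⟨C, hC⟩ := (Metric.isBounded_range_of_tendsto _ h1).exists_norm_le
  refine ⟨C, fun n => ?_⟩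
  have := hC _ ⟨n.natPred, rfl⟩
  simp only [DirSeries.partialSum] at this
  rw [Finset.sum_range_succ_sub_sum,
    PNat.succPNat_natPred, norm_smul, norm_natCast_cpow_neg, Complex.one_re,
    Real.rpow_neg_one, inv_mul_le_iff₀ (by simp)] at this
  rwa [mul_comm]

theorem summable_norm_of_three_le {D : DirSeries X} {C : ℝ} (hC : ∀ n : ℕ+, ‖D n‖ ≤ C * n)
    {s : ℂ} (hs : 3 ≤ s.re) :
    Summable fun n : ℕ => ‖((n.succPNat : ℕ+) : ℂ) ^ (-s) • D n.succPNat‖ := by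
  have h0 : Summable fun n : ℕ => C * ((n + 1 : ℕ) : ℝ) ^ (-2 : ℝ) :=
    ((summable_nat_add_iff 1).2 (Real.summable_nat_rpow.2 (by norm_num))).mul_left C
  refine h0.of_nonneg_of_le (fun _ => norm_nonneg _) fun n => ?_
  rw [norm_smul, norm_natCast_cpow_neg, Nat.succPNat_coe, Nat.succ_eq_add_one]
  have h1 : (1 : ℝ) ≤ ((n + 1 : ℕ) : ℝ) := by simp
  have h2 := hC n.succPNat
  rw [Nat.succPNat_coe, Nat.succ_eq_add_one] at h2
  calc ((n + 1 : ℕ) : ℝ) ^ (-s.re) * ‖D n.succPNat‖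
      ≤ ((n + 1 : ℕ) : ℝ) ^ (-3 : ℝ) * (C * ((n + 1 : ℕ) : ℝ)) := by
        gcongr
    _ = C * (((n + 1 : ℕ) : ℝ) ^ (-3 : ℝ) * ((n + 1 : ℕ) : ℝ) ^ (1 : ℝ)) := by
        rw [Real.rpow_one]; ring
    _ = _ := by rw [← Real.rpow_add (by linarith)]; norm_num

/-- Differentiation under the integral; Cauchy's estimate on circles of radius `r` bounds the
derivative by `M / r` uniformly in `w`. -/
theorem differentiableOn_kernel_integral [CompleteSpace X] {F : ℂ → X} {M : ℝ}
    (hF : DifferentiableOn ℂ F {s : ℂ | 0 < s.re}) (hM : ∀ s : ℂ, 0 < s.re → ‖F s‖ ≤ M)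
    {K : ℝ → ℂ} (hK : Integrable K) :
    DifferentiableOn ℂ (fun s : ℂ => ∫ w : ℝ, K w • F (s - (2 * Real.pi * w : ℝ) * Complex.I))
      {s : ℂ | 0 < s.re} := by
  have hopen : IsOpen {s : ℂ | 0 < s.re} := isOpen_lt continuous_const Complex.continuous_re
  intro s₀ (hs₀ : 0 < s₀.re)
  have hre : ∀ (s : ℂ) (w : ℝ), (s - (2 * Real.pi * w : ℝ) * Complex.I).re = s.re := by
    intro s w; simp
  have hline : ∀ s : ℂ, Continuous fun w : ℝ => s - (2 * Real.pi * w : ℝ) * Complex.I := by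
    intro s; fun_prop
  have hFc : ∀ s : ℂ, 0 < s.re →
      Continuous fun w : ℝ => F (s - (2 * Real.pi * w : ℝ) * Complex.I) := fun s hs =>
    hF.continuousOn.comp_continuous (hline s) fun w => by simpa [hre] using hs
  have hF'c : Continuous fun w : ℝ => deriv F (s₀ - (2 * Real.pi * w : ℝ) * Complex.I) :=
    (hF.deriv hopen).continuousOn.comp_continuous (hline s₀) fun w => by simpa [hre] using hs₀
  -- Circles of radius `r` about points of the ball of radius `r` around `s₀` stay at distance at
  -- least `s₀.re / 2` from the boundary.
  set r : ℝ := s₀.re / 4 with hr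
  have hr0 : 0 < r := by positivity
  have hball : ∀ s ∈ Metric.closedBall s₀ (2 * r), 0 < s.re := by
    intro s hs
    have h1 : |(s - s₀).re| ≤ 2 * r :=
      (Complex.abs_re_le_norm _).trans (mem_closedBall_iff_norm.1 hs)
    rw [Complex.sub_re, abs_le] at h1
    linarith
  have hball' : ∀ s ∈ Metric.ball s₀ r, ∀ z ∈ Metric.closedBall s r, 0 < z.re := by
    intro s hs z hz
    refine hball z (Metric.mem_closedBall.2 ?_)
    have := dist_triangle z s s₀
    have h1 := Metric.mem_ball.1 hs
    have h2 := Metric.mem_closedBall.1 hz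
    linarith
  have h := hasDerivAt_integral_of_dominated_loc_of_deriv_le (μ := volume)
    (F := fun (s : ℂ) (w : ℝ) => K w • F (s - (2 * Real.pi * w : ℝ) * Complex.I))
    (F' := fun (s : ℂ) (w : ℝ) => K w • deriv F (s - (2 * Real.pi * w : ℝ) * Complex.I))
    (bound := fun w => ‖K w‖ * (M / r)) (Metric.ball_mem_nhds s₀ hr0) ?_ ?_ ?_ ?_ ?_ ?_
  · exact h.2.differentiableAt.differentiableWithinAt
  · filter_upwards [hopen.mem_nhds hs₀] with s hs
    exact hK.aestronglyMeasurable.smul (hFc s hs).aestronglyMeasurable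
  · exact hK.smul_bdd M (hFc s₀ hs₀).aestronglyMeasurable
      (Eventually.of_forall fun w => hM _ (by rw [hre]; exact hs₀))
  · exact hK.aestronglyMeasurable.smul hF'c.aestronglyMeasurable
  · refine Eventually.of_forall fun w s hs => ?_
    rw [norm_smul]
    gcongr
    have hsub : ∀ z ∈ Metric.closedBall (s - (2 * Real.pi * w : ℝ) * Complex.I) r, 0 < z.re := by
      intro z hz
      have := hball' s hs (z + (2 * Real.pi * w : ℝ) * Complex.I) (by
        rw [mem_closedBall_iff_norm] at hz ⊢
        rwa [← sub_sub_eq_add_sub] at *)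
      simpa using this
    refine Complex.norm_deriv_le_of_forall_mem_sphere_norm_le hr0
      (DifferentiableOn.diffContOnCl ?_) fun z hz =>
        hM z (hsub z (Metric.sphere_subset_closedBall hz))
    refine hF.mono fun z hz => hsub z (Metric.closure_ball_subset_closedBall hz)
  · exact hK.norm.mul_const _
  · refine Eventually.of_forall fun w s hs => ?_
    have hs' : 0 < (s - (2 * Real.pi * w : ℝ) * Complex.I).re := by
      rw [hre]; exact hball' s hs s (Metric.mem_closedBall_self hr0.le)
    have h1 := (hF.differentiableAt (hopen.mem_nhds hs')).hasDerivAt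
    exact (h1.comp_sub_const s _).const_smul (K w)

/-- Far to the right the series converges absolutely, so averaging `F` over vertical translates
gives a Dirichlet polynomial. The identity theorem extends this to `Re s > 0`, where the average is
at most `M ‖K‖₁`. Letting `Re s → 0` and applying Kronecker's theorem moves the bound to the torus.
-/
theorem KernelBound.of_bounded [CompleteSpace X] {D : DirSeries X} {F : ℂ → X} {M : ℝ}
    (hD : ∀ s : ℂ, 0 < s.re → Tendsto (D.partialSum s) atTop (𝓝 (F s)))
    (hF : DifferentiableOn ℂ F {s : ℂ | 0 < s.re}) (hM : ∀ s : ℂ, 0 < s.re → ‖F s‖ ≤ M) :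
    KernelBound M D := by
  intro K N hK hN
  set E : DirSeries X := fun n => kernelCoeff K n • D n
  obtain ⟨C, hC⟩ := exists_norm_le_mul_of_tendsto (hD 1 (by simp))
  have hopen : IsOpen {s : ℂ | 0 < s.re} := isOpen_lt continuous_const Complex.continuous_re
  -- Convergence at `s = 1` gives `a_n = O(n)`, so the terms are `O(n^{-2})` here.
  have hlarge : ∀ s : ℂ, 3 ≤ s.re →
      ∫ w : ℝ, K w • F (s - (2 * Real.pi * w : ℝ) * Complex.I) = E.partialSum s N := by
    intro s hs
    have hs0 : 0 < s.re := by linarith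
    have hterm : ∀ (w : ℝ) (n : ℕ), ((n.succPNat : ℕ+) : ℂ) ^
        (-(s - (2 * Real.pi * w : ℝ) * Complex.I)) • D n.succPNat =
        torusChar n.succPNat (torusFlow (-(2 * Real.pi * w))) •
          ((n.succPNat : ℕ+) : ℂ) ^ (-s) • D n.succPNat := by
      intro w n
      rw [torusChar_torusFlow, smul_smul,
        ← Complex.cpow_add _ _ (Nat.cast_ne_zero.2 (PNat.ne_zero _))]
      congr 2; push_cast; ring
    have hsum : ∀ w : ℝ, K w • F (s - (2 * Real.pi * w : ℝ) * Complex.I) =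
        ∑' n : ℕ, (torusChar n.succPNat (torusFlow (-(2 * Real.pi * w))) * K w) •
          ((n.succPNat : ℕ+) : ℂ) ^ (-s) • D n.succPNat := by
      intro w
      have hw : 3 ≤ (s - (2 * Real.pi * w : ℝ) * Complex.I).re := by simpa using hs
      have h1 := (summable_norm_of_three_le hC hw).of_norm.hasSum.tendsto_sum_nat
      have h2 := tendsto_nhds_unique (hD _ (by linarith)) h1
      rw [h2, ← tsum_const_smul'' (K w)]
      refine tsum_congr fun n => ?_
      rw [hterm, smul_smul, mul_comm]
    simp only [hsum]
    have hi := hasSum_integral_of_summable_integral_norm (μ := volume)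
      (F := fun (n : ℕ) (w : ℝ) => (torusChar n.succPNat (torusFlow (-(2 * Real.pi * w))) * K w) •
          ((n.succPNat : ℕ+) : ℂ) ^ (-s) • D n.succPNat)
      (fun n => (torusChar_kernel_integrable hK _).smul_const _) ?_
    · rw [← hi.tsum_eq, tsum_eq_sum (s := Finset.range N)]
      · refine Finset.sum_congr rfl fun n _ => ?_
        rw [integral_smul_const, smul_comm]
        rfl
      · intro n hn
        rw [integral_smul_const]
        have := hN n (not_lt.1 fun h => hn (Finset.mem_range.2 h))
        rw [kernelCoeff] at this
        rw [this, zero_smul]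
    · simp only [norm_smul _ (_ • D _), norm_mul, torusChar_norm, one_mul, integral_mul_const]
      exact (summable_norm_of_three_le hC hs).mul_left _
  have hEdiff : Differentiable ℂ fun s => E.partialSum s N := by
    unfold DirSeries.partialSum
    refine Differentiable.fun_sum fun n _ => Differentiable.smul_const ?_ _
    exact differentiable_neg.const_cpow (Or.inl (Nat.cast_ne_zero.2 (PNat.ne_zero _)))
  have heq : Set.EqOn (fun s : ℂ => ∫ w : ℝ, K w • F (s - (2 * Real.pi * w : ℝ) * Complex.I))
      (fun s => E.partialSum s N) {s : ℂ | 0 < s.re} := by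
    refine AnalyticOnNhd.eqOn_of_preconnected_of_eventuallyEq
      ((differentiableOn_kernel_integral hF hM hK).analyticOnNhd hopen)
      (hEdiff.differentiableOn.analyticOnNhd hopen)
      (convex_halfSpace_re_gt 0).isPreconnected (z₀ := 4) (by simp) ?_
    filter_upwards [(isOpen_lt continuous_const Complex.continuous_re).mem_nhds
      (show (3 : ℝ) < (4 : ℂ).re by norm_num)] with s hs
    exact hlarge s (le_of_lt hs)
  have hpos : ∀ s : ℂ, 0 < s.re → ‖E.partialSum s N‖ ≤ M * ∫ w, ‖K w‖ := by
    intro s hs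
    rw [← show _ = E.partialSum s N from heq hs, ← integral_const_mul]
    refine norm_integral_le_of_norm_le (hK.norm.const_mul _) (Eventually.of_forall fun w => ?_)
    rw [norm_smul, mul_comm]
    gcongr
    exact hM _ (by simpa using hs)
  refine norm_torusSum_le_of_torusFlow E N fun t => ?_
  have h0 : torusSum E N (torusFlow t) = E.partialSum (t * Complex.I) N := by
    refine Finset.sum_congr rfl fun n _ => ?_
    rw [torusChar_torusFlow]
  have hlim : Tendsto (fun σ : ℝ => E.partialSum ((σ : ℂ) + t * Complex.I) N) (𝓝[>] 0)
      (𝓝 (E.partialSum (((0 : ℝ) : ℂ) + t * Complex.I) N)) :=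
    ((hEdiff.continuous.comp (by fun_prop : Continuous fun σ : ℝ =>
      (σ : ℂ) + t * Complex.I)).tendsto 0).mono_left nhdsWithin_le_nhds
  rw [h0]
  rw [Complex.ofReal_zero, zero_add] at hlim
  refine le_of_tendsto hlim.norm ?_
  filter_upwards [self_mem_nhdsWithin] with σ hσ
  exact hpos _ (by simpa using hσ)

/-! ### Trapezoidal multipliers with small `L_1` cost -/

open FourierTransform in
theorem kernelCoeff_fourier {T : ℝ → ℂ} (n : ℕ+) :
    kernelCoeff (𝓕 T) n = 𝓕⁻ (𝓕 T) (Real.log (n : ℕ)) := by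
  rw [Real.fourierInv_eq', kernelCoeff]
  refine integral_congr_ae (Eventually.of_forall fun w => ?_)
  simp only [torusChar_torusFlow, smul_eq_mul]
  rw [Complex.cpow_def_of_ne_zero (by simp), Complex.natCast_log.symm]
  congr 2
  rw [real_inner_eq_re_inner ℝ, RCLike.inner_apply, conj_trivial, RCLike.re_to_real]
  push_cast; ring

theorem abs_sin_le_rpow {δ : ℝ} (hδ : 0 ≤ δ) (hδ1 : δ ≤ 1) (x : ℝ) : |Real.sin x| ≤ |x| ^ δ := by
  rcases le_or_gt 1 |x| with h | h
  · exact (Real.abs_sin_le_one x).trans (Real.one_le_rpow h hδ)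
  · exact Real.abs_sin_le_abs.trans ((Real.self_le_rpow_of_le_one (abs_nonneg x) h.le hδ1))

/-- An integrable even majorant for the Fourier transforms of trapezoids. -/
def powerMajorant (δ w : ℝ) : ℝ := if |w| ≤ 1 then |w| ^ (δ - 1) else |w| ^ (-1 - δ)

theorem powerMajorant_integrable {δ : ℝ} (hδ : 0 < δ) : Integrable (powerMajorant δ) := by
  have h1 : IntegrableOn (powerMajorant δ) (Set.Ioi 0) := by
    rw [← Set.Ioc_union_Ioi_eq_Ioi zero_le_one]
    refine IntegrableOn.union ?_ ?_
    · have h := (intervalIntegral.intervalIntegrable_rpow' (a := 0) (b := 1)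
        (by linarith : -1 < δ - 1)).1
      refine h.congr_fun (fun w hw => ?_) measurableSet_Ioc
      rw [powerMajorant, abs_of_pos hw.1, if_pos hw.2]
    · refine (integrableOn_Ioi_rpow_of_lt (by linarith : -1 - δ < -1) zero_lt_one).congr_fun
        (fun w hw => ?_) measurableSet_Ioi
      have hw' : (1 : ℝ) < w := hw
      rw [powerMajorant, abs_of_pos (by linarith), if_neg (not_le.2 hw')]
  have h2 : IntegrableOn (powerMajorant δ) (Set.Iic 0) := by
    rw [← Measure.map_neg_eq_self (volume : Measure ℝ)]
    have m : MeasurableEmbedding fun x : ℝ => -x := (Homeomorph.neg ℝ).measurableEmbedding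
    rw [m.integrableOn_map_iff]
    simp only [Function.comp_def, powerMajorant, abs_neg, Set.neg_preimage, Set.neg_Iic, neg_zero]
    exact Iff.mpr integrableOn_Ici_iff_integrableOn_Ioi h1
  rw [← integrableOn_univ, ← Set.Iic_union_Ioi (a := (0 : ℝ))]
  exact h2.union h1

open FourierTransform in
theorem norm_fourier_indicator_Icc {a : ℝ} (ha : 0 ≤ a) {w : ℝ} (hw : w ≠ 0) :
    ‖𝓕 ((Set.Icc (-a) a).indicator fun _ => (1 : ℂ)) w‖
      = |Real.sin (2 * Real.pi * a * w)| / (Real.pi * |w|) := by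
  have hc : ((-2 * Real.pi * w : ℝ) : ℂ) * Complex.I ≠ 0 := by
    simp [hw, Real.pi_ne_zero]
  have h1 : 𝓕 ((Set.Icc (-a) a).indicator fun _ => (1 : ℂ)) w
      = ∫ x in (-a)..a, Complex.exp (((-2 * Real.pi * w : ℝ) : ℂ) * Complex.I * x) := by
    rw [Real.fourier_real_eq_integral_exp_smul, intervalIntegral.integral_of_le (by linarith),
      ← integral_Icc_eq_integral_Ioc, ← integral_indicator measurableSet_Icc]
    refine integral_congr_ae (Eventually.of_forall fun x => ?_)
    by_cases hx : x ∈ Set.Icc (-a) a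
    · simp only [Set.indicator_of_mem hx, smul_eq_mul, mul_one]
      congr 1; push_cast; ring
    · simp only [Set.indicator_of_notMem hx, smul_zero]
  have h2 : Complex.exp (((-2 * Real.pi * w : ℝ) : ℂ) * Complex.I * a)
      - Complex.exp (((-2 * Real.pi * w : ℝ) : ℂ) * Complex.I * (-a : ℝ))
      = ((-2 * Real.sin (2 * Real.pi * a * w) : ℝ) : ℂ) * Complex.I := by
    rw [show ((-2 * Real.pi * w : ℝ) : ℂ) * Complex.I * a
        = -((2 * Real.pi * a * w : ℝ) : ℂ) * Complex.I by push_cast; ring,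
      show ((-2 * Real.pi * w : ℝ) : ℂ) * Complex.I * (-a : ℝ)
        = ((2 * Real.pi * a * w : ℝ) : ℂ) * Complex.I by push_cast; ring,
      Complex.exp_mul_I, Complex.exp_mul_I, Complex.cos_neg, Complex.sin_neg]
    push_cast; ring
  rw [h1, integral_exp_mul_complex hc, h2, norm_div, norm_mul, norm_mul, Complex.norm_real,
    Complex.norm_real, Complex.norm_I, Real.norm_eq_abs, Real.norm_eq_abs, mul_one, mul_one,
    abs_mul, abs_mul, abs_mul, abs_neg, abs_of_pos Real.pi_pos, abs_of_pos (zero_lt_two' ℝ)]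
  have : |w| ≠ 0 := abs_ne_zero.2 hw
  field_simp

/-- The convolution of the indicators of two intervals around the origin, normalized to be `1`
near the origin. -/
def trapezoid (a h : ℝ) : ℝ → ℂ :=
  (1 / (2 * h) : ℂ) • convolution ((Set.Icc (-h) h).indicator fun _ => (1 : ℂ))
    ((Set.Icc (-a) a).indicator fun _ => (1 : ℂ)) (ContinuousLinearMap.mul ℂ ℂ) volume

theorem indicator_Icc_integrable (a : ℝ) :
    Integrable ((Set.Icc (-a) a).indicator fun _ => (1 : ℂ)) :=
  (integrable_indicator_iff measurableSet_Icc).2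
    (integrableOn_const (by simp))

theorem trapezoid_integrable (a h : ℝ) : Integrable (trapezoid a h) :=
  Integrable.smul _ ((indicator_Icc_integrable h).integrable_convolution _
    (indicator_Icc_integrable a))

theorem trapezoid_eq_one {a h x : ℝ} (hh : 0 < h) (hx : |x| + h ≤ a) : trapezoid a h x = 1 := by
  have h1 : ∀ t, (Set.Icc (-h) h).indicator (fun _ => (1 : ℂ)) t *
      (Set.Icc (-a) a).indicator (fun _ => (1 : ℂ)) (x - t)
      = (Set.Icc (-h) h).indicator (fun _ => (1 : ℂ)) t := by
    intro t
    by_cases ht : t ∈ Set.Icc (-h) h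
    · have := abs_le.1 (le_refl |x|)
      rw [Set.indicator_of_mem (show x - t ∈ Set.Icc (-a) a from
        ⟨by linarith [ht.2], by linarith [ht.1]⟩), mul_one]
    · rw [Set.indicator_of_notMem ht, zero_mul]
  simp only [trapezoid, Pi.smul_apply, convolution, ContinuousLinearMap.mul_apply', h1]
  rw [integral_indicator measurableSet_Icc]
  have : (h : ℂ) ≠ 0 := by exact_mod_cast hh.ne'
  simp [Real.volume_real_Icc_of_le (show -h ≤ h by linarith)]
  rw [← two_mul]
  field_simp

theorem trapezoid_eq_zero {a h x : ℝ} (hx : a + h < |x|) : trapezoid a h x = 0 := by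
  have h1 : ∀ t, (Set.Icc (-h) h).indicator (fun _ => (1 : ℂ)) t *
      (Set.Icc (-a) a).indicator (fun _ => (1 : ℂ)) (x - t) = 0 := by
    intro t
    by_cases ht : t ∈ Set.Icc (-h) h
    · have hxt : x - t ∉ Set.Icc (-a) a := fun hxt => by
        have : |x| ≤ a + h := abs_le.2 ⟨by linarith [ht.1, hxt.1], by linarith [ht.2, hxt.2]⟩
        linarith
      rw [Set.indicator_of_notMem hxt, mul_zero]
    · rw [Set.indicator_of_notMem ht, zero_mul]
  simp only [trapezoid, Pi.smul_apply, convolution, ContinuousLinearMap.mul_apply', h1]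
  simp

open FourierTransform in
theorem norm_fourier_trapezoid {a h : ℝ} (ha : 0 ≤ a) (hh : 0 < h) {w : ℝ} (hw : w ≠ 0) :
    ‖𝓕 (trapezoid a h) w‖ = |Real.sin (2 * Real.pi * a * w)| * |Real.sin (2 * Real.pi * h * w)|
      / (2 * h * (Real.pi * |w|) ^ 2) := by
  have hsmul : ∀ (c : ℂ) (f : ℝ → ℂ), 𝓕 (c • f) w = c • 𝓕 f w := fun c f => by
    simp only [Real.fourier_real_eq, ← integral_smul, Pi.smul_apply, smul_comm c]
  rw [trapezoid, hsmul, Real.fourier_mul_convolution_eq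
    (indicator_Icc_integrable h) (indicator_Icc_integrable a), norm_smul, norm_mul,
    norm_fourier_indicator_Icc hh.le hw, norm_fourier_indicator_Icc ha hw]
  have : |w| ≠ 0 := abs_ne_zero.2 hw
  have h2 : ‖(1 / (2 * h) : ℂ)‖ = 1 / (2 * h) := by
    rw [norm_div, norm_mul, Complex.norm_real, Real.norm_of_nonneg hh.le]; simp
  rw [h2]
  field_simp

open FourierTransform in
-- The transform is a product of two sines over `2h(πw)²`. For `|w| ≤ 1` the sine with `h` is
-- bounded linearly and the one with `a` by a power `δ`. For `|w| > 1` the sine with `a` is bounded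
-- by `1` and the one with `h` by the power `1 - δ`; then `h^{1-δ} = h · h^{-δ}` with `h^{-δ} ≤
-- (8m)^δ`. In both cases the factor `h` cancels and only `m^δ` remains.
theorem norm_fourier_trapezoid_le {δ : ℝ} (hδ : 0 < δ) (hδ1 : δ < 1) {a h m : ℝ} (ha : 0 ≤ a)
    (hm : 1 ≤ m) (ham : a ≤ m) (hhm : 1 / (8 * m) ≤ h) {w : ℝ} (hw : w ≠ 0) :
    ‖𝓕 (trapezoid a h) w‖ ≤ 8 * m ^ δ * powerMajorant δ w := by
  have hh : 0 < h := lt_of_lt_of_le (by positivity) hhm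
  have hw0 : 0 < |w| := abs_pos.2 hw
  have hpi := Real.pi_gt_three
  have hpi4 := Real.pi_le_four
  have habs : ∀ b : ℝ, 0 ≤ b → |2 * Real.pi * b * w| = 2 * Real.pi * b * |w| := fun b hb => by
    rw [abs_mul, abs_of_nonneg (by positivity)]
  have h8 : (8 * m) ^ δ ≤ 8 * m ^ δ := by
    rw [Real.mul_rpow (by norm_num) (by positivity)]
    gcongr
    exact Real.rpow_le_self_of_one_le (by norm_num) hδ1.le
  rw [norm_fourier_trapezoid ha hh hw, powerMajorant, div_le_iff₀ (by positivity)]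
  split_ifs with h1
  · have s1 : |Real.sin (2 * Real.pi * a * w)| ≤ 8 * m ^ δ * |w| ^ δ := by
      refine (abs_sin_le_rpow hδ.le hδ1.le _).trans ?_
      rw [habs a ha, Real.mul_rpow (by positivity) hw0.le]
      gcongr
      refine le_trans ?_ h8
      gcongr
      linarith
    have s2 : |Real.sin (2 * Real.pi * h * w)| ≤ 2 * Real.pi * h * |w| := by
      rw [← habs h hh.le]; exact Real.abs_sin_le_abs
    have e : |w| ^ δ = |w| ^ (δ - 1) * |w| := by
      rw [← Real.rpow_add_one hw0.ne', sub_add_cancel]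
    calc _ ≤ 8 * m ^ δ * |w| ^ δ * (2 * Real.pi * h * |w|) := by gcongr
      _ = (8 * m ^ δ * |w| ^ (δ - 1)) * (2 * h * (Real.pi * |w| ^ 2)) := by rw [e]; ring
      _ ≤ _ := by
        gcongr
        rw [mul_pow]
        gcongr
        nlinarith
  · have s1 : |Real.sin (2 * Real.pi * a * w)| ≤ 1 := Real.abs_sin_le_one _
    have s2 : |Real.sin (2 * Real.pi * h * w)| ≤
        (2 * Real.pi) * (h * (8 * m ^ δ)) * |w| ^ (1 - δ) := by
      refine (abs_sin_le_rpow (by linarith : 0 ≤ 1 - δ) (by linarith) _).trans ?_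
      rw [habs h hh.le, Real.mul_rpow (by positivity) hw0.le, Real.mul_rpow (by positivity) hh.le]
      gcongr
      · exact Real.rpow_le_self_of_one_le (by linarith) (by linarith)
      · rw [sub_eq_add_neg, Real.rpow_add hh, Real.rpow_one, Real.rpow_neg hh.le]
        gcongr
        refine le_trans ?_ h8
        rw [← Real.inv_rpow hh.le]
        gcongr
        rw [inv_le_comm₀ hh (by positivity), ← one_div]
        exact hhm
    have e : |w| ^ (1 - δ) = |w| ^ (-1 - δ) * |w| ^ 2 := by
      rw [← Real.rpow_natCast, ← Real.rpow_add hw0]; norm_num; ring_nf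
    calc _ ≤ 1 * ((2 * Real.pi) * (h * (8 * m ^ δ)) * |w| ^ (1 - δ)) := by gcongr
      _ = (8 * m ^ δ * |w| ^ (-1 - δ)) * (2 * h * (Real.pi * |w| ^ 2)) := by rw [e]; ring
      _ ≤ _ := by
        gcongr
        rw [mul_pow]
        gcongr
        nlinarith

open FourierTransform in
-- The gap between `log N` and `log (N + 1)` is at least `1 / (2N)`, so a trapezoid can fall from
-- `1` to `0` inside it with a slope of order at most `N`. Its Fourier transform is the kernel, and
-- Fourier inversion returns the trapezoid as the multiplier.
theorem exists_kernel {δ : ℝ} (hδ : 0 < δ) (hδ1 : δ < 1) : ∃ C : ℝ, 0 ≤ C ∧ ∀ N : ℕ, 1 ≤ N →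
    ∃ K : ℝ → ℂ, Integrable K ∧ (∀ n : ℕ+, (n : ℕ) ≤ N → kernelCoeff K n = 1) ∧
      (∀ n : ℕ+, N < n → kernelCoeff K n = 0) ∧ ∫ w, ‖K w‖ ≤ C * (N : ℝ) ^ δ := by
  refine ⟨8 * ∫ w, powerMajorant δ w, mul_nonneg (by norm_num) (integral_nonneg fun w => ?_),
    fun N hN => ?_⟩
  · unfold powerMajorant; simp only [Pi.zero_apply]; split_ifs <;> positivity
  have hN1 : (1 : ℝ) ≤ N := by exact_mod_cast hN
  have hN0 : (0 : ℝ) < N := by linarith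
  set g : ℝ := Real.log (N + 1) - Real.log N with hg
  have hg0 : 1 / (2 * (N : ℝ)) ≤ g := by
    have h1 := Real.one_sub_inv_le_log_of_pos (show (0 : ℝ) < (N + 1) / N by positivity)
    rw [Real.log_div (by positivity) (by positivity)] at h1
    refine le_trans ?_ h1
    rw [inv_div, one_sub_div (by positivity), add_sub_cancel_left]
    exact one_div_le_one_div_of_le (by positivity) (by linarith)
  have hgpos : 0 < g := lt_of_lt_of_le (by positivity) hg0
  -- The descent takes place on `[log N + g/4, log N + 3g/4]`, strictly inside the gap. The
  -- trapezoid is therefore constant near every `log n`, which gives the continuity needed for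
  -- pointwise inversion.
  set a : ℝ := Real.log N + g / 2 with ha
  set h : ℝ := g / 4 with hh
  have hlog0 : 0 ≤ Real.log N := Real.log_nonneg hN1
  have ha0 : 0 ≤ a := by positivity
  have haN : a ≤ N := by
    have := Real.log_le_sub_one_of_pos (show (0 : ℝ) < N + 1 by positivity)
    linarith
  have hhN : 1 / (8 * (N : ℝ)) ≤ h := by
    have : 1 / (8 * (N : ℝ)) = 1 / (2 * (N : ℝ)) / 4 := by field_simp; norm_num
    linarith
  have hbound : ∀ᵐ w : ℝ, ‖𝓕 (trapezoid a h) w‖ ≤ 8 * (N : ℝ) ^ δ * powerMajorant δ w := by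
    filter_upwards [compl_mem_ae_iff.2 (measure_singleton (0 : ℝ))] with w hw
    exact norm_fourier_trapezoid_le hδ hδ1 ha0 hN1 haN hhN hw
  have hT := trapezoid_integrable a h
  have hmeas : Continuous (𝓕 (trapezoid a h)) :=
    VectorFourier.fourierIntegral_continuous Real.continuous_fourierChar
      (by exact continuous_inner) hT
  have hK : Integrable (𝓕 (trapezoid a h)) :=
    ((powerMajorant_integrable hδ).const_mul _).mono' hmeas.aestronglyMeasurable hbound
  refine ⟨𝓕 (trapezoid a h), hK, fun n hn => ?_, fun n hn => ?_, ?_⟩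
  · have hn1 : (1 : ℝ) ≤ (n : ℕ) := by exact_mod_cast n.pos
    have hlog : |Real.log (n : ℕ)| + h < a := by
      rw [abs_of_nonneg (Real.log_nonneg hn1)]
      have := Real.log_le_log (by linarith) (show ((n : ℕ) : ℝ) ≤ N by exact_mod_cast hn)
      linarith
    have hev : ∀ᶠ x in 𝓝 (Real.log (n : ℕ)), trapezoid a h x = 1 := by
      filter_upwards [(isOpen_lt (by fun_prop : Continuous fun x : ℝ => |x| + h)
        continuous_const).mem_nhds hlog] with x hx
      exact trapezoid_eq_one (by positivity) (le_of_lt hx)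
    rw [kernelCoeff_fourier, hT.fourierInv_fourier_eq hK
      (continuousAt_const.congr (hev.mono fun _ h => h.symm)), hev.self_of_nhds]
  · have hlog : a + h < |Real.log (n : ℕ)| := by
      have := Real.log_le_log (by linarith) (show (N : ℝ) + 1 ≤ (n : ℕ) by exact_mod_cast hn)
      refine lt_of_lt_of_le ?_ (le_abs_self _)
      linarith
    have hev : ∀ᶠ x in 𝓝 (Real.log (n : ℕ)), trapezoid a h x = 0 := by
      filter_upwards [(isOpen_lt continuous_const continuous_abs).mem_nhds hlog] with x hx
      exact trapezoid_eq_zero hx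
    rw [kernelCoeff_fourier, hT.fourierInv_fourier_eq hK
      (continuousAt_const.congr (hev.mono fun _ h => h.symm)), hev.self_of_nhds]
  · rw [mul_right_comm, ← integral_const_mul]
    exact integral_mono_ae hK.norm ((powerMajorant_integrable hδ).const_mul _) hbound

/-! ### Abel summation and Bohr's theorem -/

theorem sum_Ico_telescope (w : ℕ → ℝ) {k l : ℕ} (h : k ≤ l) :
    ∑ n ∈ Finset.Ico k l, (w n - w (n + 1)) = w k - w l := by
  induction l, h using Nat.le_induction with
  | base => simp
  | succ l h ih => rw [Finset.sum_Ico_succ_top h, ih]; ring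

theorem sum_Ico_smul_sub (w : ℕ → ℂ) (B : ℕ → X) {k l : ℕ} (h : k ≤ l) :
    ∑ n ∈ Finset.Ico k l, w n • (B (n + 1) - B n) =
      w l • B l - w k • B k + ∑ n ∈ Finset.Ico k l, (w n - w (n + 1)) • B (n + 1) := by
  induction l, h using Nat.le_induction with
  | base => simp
  | succ l h ih =>
    rw [Finset.sum_Ico_succ_top h, Finset.sum_Ico_succ_top h, ih]
    module

theorem norm_sum_Ico_smul_sub_le (w : ℕ → ℝ) (hw : Antitone w) (hw0 : ∀ n, 0 ≤ w n) (B : ℕ → X)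
    {k l : ℕ} (h : k ≤ l) :
    ‖∑ n ∈ Finset.Ico k l, (w n : ℂ) • (B (n + 1) - B n)‖ ≤
      w l * ‖B l‖ + w k * ‖B k‖ + ∑ n ∈ Finset.Ico k l, (w n - w (n + 1)) * ‖B (n + 1)‖ := by
  have hn : ∀ (r : ℝ) (x : X), 0 ≤ r → ‖(r : ℂ) • x‖ = r * ‖x‖ := fun r x hr => by
    rw [norm_smul, Complex.norm_real, Real.norm_of_nonneg hr]
  rw [sum_Ico_smul_sub (fun n => (w n : ℂ)) B h]
  refine (norm_add_le _ _).trans (add_le_add ((norm_sub_le _ _).trans ?_) ?_)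
  · rw [hn _ _ (hw0 l), hn _ _ (hw0 k)]
  · refine norm_sum_le_of_le _ fun n _ => ?_
    rw [← Complex.ofReal_sub, hn _ _ (sub_nonneg.2 (hw n.le_succ))]

/-- Abel's inequality. -/
theorem norm_sum_Ico_smul_le (w : ℕ → ℝ) (hw : Antitone w) (hw0 : ∀ n, 0 ≤ w n)
    (hw1 : ∀ n, w n ≤ 1) (b : ℕ → X) {η : ℝ} {k : ℕ}
    (hb : ∀ l, k ≤ l → ‖∑ n ∈ Finset.Ico k l, b n‖ ≤ η) {l : ℕ} (h : k ≤ l) :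
    ‖∑ n ∈ Finset.Ico k l, (w n : ℂ) • b n‖ ≤ η := by
  have hη : 0 ≤ η := (norm_nonneg _).trans (hb k le_rfl)
  have e : ∑ n ∈ Finset.Ico k l, (w n : ℂ) • b n = ∑ n ∈ Finset.Ico k l, (w n : ℂ) •
      (∑ m ∈ Finset.Ico k (n + 1), b m - ∑ m ∈ Finset.Ico k n, b m) := by
    refine Finset.sum_congr rfl fun n hn => ?_
    rw [Finset.sum_Ico_succ_top (Finset.mem_Ico.1 hn).1, add_sub_cancel_left]
  rw [e]
  refine (norm_sum_Ico_smul_sub_le w hw hw0 (fun n => ∑ m ∈ Finset.Ico k n, b m) h).trans ?_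
  calc _ ≤ w l * η + w k * 0 + ∑ n ∈ Finset.Ico k l, (w n - w (n + 1)) * η := by
        refine add_le_add (add_le_add ?_ ?_) (Finset.sum_le_sum fun n hn => ?_)
        · exact mul_le_mul_of_nonneg_left (hb l h) (hw0 l)
        · simp
        · exact mul_le_mul_of_nonneg_left (hb _ ((Finset.mem_Ico.1 hn).1.trans n.le_succ))
            (sub_nonneg.2 (hw n.le_succ))
    _ = w k * η := by
        rw [← Finset.sum_mul, sum_Ico_telescope w h]; ring
    _ ≤ η := mul_le_of_le_one_left hη (hw1 k)

/-- Summation by parts with `x_n² - x_{n+1}² = (x_n - x_{n+1})(x_n + x_{n+1})`: one factor absorbs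
the growth of the partial sums, the other telescopes and leaves the decay `x_k`. -/
theorem norm_sum_Ico_sq_smul_le (x : ℕ → ℝ) (hx : Antitone x) (hx0 : ∀ n, 0 ≤ x n) (b : ℕ → X)
    {C : ℝ} (hC : ∀ n, x n * ‖∑ m ∈ Finset.range n, b m‖ ≤ C)
    (hC' : ∀ n, x n * ‖∑ m ∈ Finset.range (n + 1), b m‖ ≤ C) {k l : ℕ} (h : k ≤ l) :
    ‖∑ n ∈ Finset.Ico k l, ((x n ^ 2 : ℝ) : ℂ) • b n‖ ≤ 3 * C * x k := by
  have hC0 : 0 ≤ C := (mul_nonneg (hx0 0) (norm_nonneg _)).trans (hC 0)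
  have e : ∑ n ∈ Finset.Ico k l, ((x n ^ 2 : ℝ) : ℂ) • b n = ∑ n ∈ Finset.Ico k l,
      ((x n ^ 2 : ℝ) : ℂ) • (∑ m ∈ Finset.range (n + 1), b m - ∑ m ∈ Finset.range n, b m) := by
    refine Finset.sum_congr rfl fun n _ => ?_
    rw [Finset.sum_range_succ_sub_sum]
  rw [e]
  refine (norm_sum_Ico_smul_sub_le (fun n => x n ^ 2)
    (fun i j hij => pow_le_pow_left₀ (hx0 j) (hx hij) 2) (fun n => sq_nonneg _)
    (fun n => ∑ m ∈ Finset.range n, b m) h).trans ?_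
  have hsq : ∀ n, x n ^ 2 * ‖∑ m ∈ Finset.range n, b m‖ ≤ x n * C := fun n => by
    rw [sq, mul_assoc]; exact mul_le_mul_of_nonneg_left (hC n) (hx0 n)
  have hterm : ∀ n, (x n ^ 2 - x (n + 1) ^ 2) * ‖∑ m ∈ Finset.range (n + 1), b m‖
      ≤ (x n - x (n + 1)) * (2 * C) := fun n => by
    have h1 : (x n ^ 2 - x (n + 1) ^ 2) * ‖∑ m ∈ Finset.range (n + 1), b m‖
        = (x n - x (n + 1)) * ((x n + x (n + 1)) * ‖∑ m ∈ Finset.range (n + 1), b m‖) := by ring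
    rw [h1]
    refine mul_le_mul_of_nonneg_left ?_ (sub_nonneg.2 (hx n.le_succ))
    have h2 : x (n + 1) * ‖∑ m ∈ Finset.range (n + 1), b m‖ ≤ C := hC (n + 1)
    linarith [hC' n]
  calc _ ≤ x l * C + x k * C + ∑ n ∈ Finset.Ico k l, (x n - x (n + 1)) * (2 * C) :=
        add_le_add (add_le_add (hsq l) (hsq k)) (Finset.sum_le_sum fun n _ => hterm n)
    _ = 3 * C * x k - C * x l := by
        rw [← Finset.sum_mul, sum_Ico_telescope x h]; ring
    _ ≤ 3 * C * x k := sub_le_self _ (mul_nonneg hC0 (hx0 l))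

theorem KernelBound.exists_norm_torusSum_le {M : ℝ} (hM : 0 ≤ M) {D : DirSeries X}
    (h : KernelBound M D) {δ : ℝ} (hδ : 0 < δ) (hδ1 : δ < 1) :
    ∃ C : ℝ, 0 ≤ C ∧ ∀ N ω, ‖torusSum D N ω‖ ≤ C * (N : ℝ) ^ δ := by
  obtain ⟨C, hC0, hC⟩ := exists_kernel hδ hδ1
  refine ⟨M * C, mul_nonneg hM hC0, fun N ω => ?_⟩
  rcases Nat.eq_zero_or_pos N with rfl | hN
  · simp [torusSum, hδ.ne']
  obtain ⟨K, hK, h1, h0, hb⟩ := hC N hN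
  have := h K N hK (fun n hn => h0 _ (by rw [Nat.succPNat_coe]; omega)) ω
  have e : torusSum (fun n => kernelCoeff K n • D n) N ω = torusSum D N ω := by
    refine Finset.sum_congr rfl fun n hn => ?_
    simp only
    rw [h1 _ (by rw [Nat.succPNat_coe]; exact Finset.mem_range.1 hn), one_smul]
  rw [e] at this
  refine this.trans ?_
  rw [mul_assoc]
  exact mul_le_mul_of_nonneg_left hb hM

/-- The increment `∑_{k ≤ n < l}` of the partial sums on the infinite torus. -/
theorem torusSum_sub (D : DirSeries X) {k l : ℕ} (h : k ≤ l) (ω : InfTorus) :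
    torusSum D l ω - torusSum D k ω
      = ∑ n ∈ Finset.Ico k l, torusChar n.succPNat ω • D n.succPNat :=
  (Finset.sum_Ico_eq_sub _ h).symm

theorem natCast_cpow_ofReal (n : ℕ+) (σ : ℝ) :
    (n : ℂ) ^ (-(σ : ℂ)) = (((n : ℝ) ^ (-σ) : ℝ) : ℂ) := by
  rw [Complex.ofReal_cpow (by positivity)]
  simp

theorem antitone_succPNat_rpow {σ : ℝ} (hσ : 0 ≤ σ) :
    Antitone fun n : ℕ => ((n.succPNat : ℕ) : ℝ) ^ (-σ) := fun i j hij => by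
  refine Real.rpow_le_rpow_of_nonpos (Nat.cast_pos.2 (PNat.pos _)) ?_ (by linarith)
  simpa using hij

theorem tendsto_succPNat_rpow {σ : ℝ} (hσ : 0 < σ) :
    Tendsto (fun n : ℕ => ((n.succPNat : ℕ) : ℝ) ^ (-σ)) atTop (𝓝 0) := by
  refine (tendsto_rpow_neg_atTop hσ).comp ?_
  simp only [Nat.succPNat_coe]
  exact tendsto_natCast_atTop_atTop.comp (tendsto_add_atTop_nat 1)

/-- Bohr's theorem: uniform convergence on closed half-planes inside `Re s > 0`. -/
theorem KernelBound.exists_tail_bound {M : ℝ} (hM : 0 ≤ M) {D : DirSeries X}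
    (h : KernelBound M D) {ε : ℝ} (hε : 0 < ε) :
    ∃ η : ℕ → ℝ, Tendsto η atTop (𝓝 0) ∧ ∀ σ : ℝ, ε ≤ σ → ∀ k l, k ≤ l → ∀ ω,
      ‖torusSum (D.translate σ) l ω - torusSum (D.translate σ) k ω‖ ≤ η k := by
  -- With `2δ ≤ ε` one can split `n^{-σ} = n^{-(σ - 2δ)} (n^{-δ})²`. The square gives a tail bound
  -- independent of `σ`; the first factor decreases and is at most `1`, so Abel's inequality
  -- preserves that bound.
  set δ : ℝ := min (ε / 2) (1 / 2) with hδ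
  have hδ0 : 0 < δ := by positivity
  have hδε : 2 * δ ≤ ε := by linarith [min_le_left (ε / 2) (1 / 2)]
  obtain ⟨C, hC0, hC⟩ := h.exists_norm_torusSum_le hM hδ0
    (lt_of_le_of_lt (min_le_right _ _) (by norm_num))
  set x : ℕ → ℝ := fun n => ((n.succPNat : ℕ) : ℝ) ^ (-δ) with hx
  have hx0 : ∀ n, 0 ≤ x n := fun n => by positivity
  have hpos : ∀ n : ℕ, (0 : ℝ) < ((n.succPNat : ℕ) : ℝ) := fun n => Nat.cast_pos.2 (PNat.pos _)
  have hxC : ∀ (n m : ℕ), m ≤ n + 1 → ∀ ω, x n * ‖torusSum D m ω‖ ≤ C := fun n m hm ω => by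
    have h1 : ((m : ℕ) : ℝ) ^ δ ≤ ((n.succPNat : ℕ) : ℝ) ^ δ := by
      refine Real.rpow_le_rpow (by positivity) ?_ hδ0.le
      rw [Nat.succPNat_coe]; exact_mod_cast hm
    calc x n * ‖torusSum D m ω‖ ≤ x n * (C * ((n.succPNat : ℕ) : ℝ) ^ δ) := by
          exact mul_le_mul_of_nonneg_left
            ((hC m ω).trans (mul_le_mul_of_nonneg_left h1 hC0)) (hx0 n)
      _ = C * (x n * ((n.succPNat : ℕ) : ℝ) ^ δ) := by ring
      _ = C := by
        rw [hx]; simp only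
        rw [← Real.rpow_add (hpos n), neg_add_cancel, Real.rpow_zero, mul_one]
  refine ⟨fun k => 3 * C * x k, mul_zero (3 * C) ▸ (tendsto_succPNat_rpow hδ0).const_mul (3 * C),
    fun σ hσ k l hkl ω => ?_⟩
  have hsplit : ∀ n : ℕ, torusChar n.succPNat ω • D.translate σ n.succPNat =
      ((((n.succPNat : ℕ) : ℝ) ^ (-(σ - 2 * δ)) : ℝ) : ℂ) •
        ((x n ^ 2 : ℝ) : ℂ) • torusChar n.succPNat ω • D n.succPNat := fun n => by
    rw [DirSeries.translate, natCast_cpow_ofReal, smul_comm (torusChar _ _),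
      smul_smul (_ : ℂ) (_ : ℂ) (torusChar _ _ • _), ← Complex.ofReal_mul]
    congr 3
    rw [hx]; simp only
    rw [← Real.rpow_natCast, ← Real.rpow_mul (hpos n).le, ← Real.rpow_add (hpos n)]
    congr 1; push_cast; ring
  rw [torusSum_sub _ hkl, Finset.sum_congr rfl fun n _ => hsplit n]
  refine norm_sum_Ico_smul_le _ (antitone_succPNat_rpow (by linarith)) (fun n => by positivity)
    (fun n => Real.rpow_le_one_of_one_le_of_nonpos (by simp) (by linarith)) _ (fun l' hl' => ?_) hkl
  exact norm_sum_Ico_sq_smul_le x (antitone_succPNat_rpow hδ0.le) hx0 _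
    (fun n => hxC n n n.le_succ ω) (fun n => hxC n (n + 1) le_rfl ω) hl'

/-! ### From the Hardy space to the half-plane -/

theorem FejerBound.mono {M M' : ℝ} {D : DirSeries X} (h : FejerBound M D) (hM : M ≤ M') :
    FejerBound M' D := fun B N hN ω =>
  (h B N hN ω).trans (mul_le_mul_of_nonneg_right hM (Nat.cast_nonneg _))

theorem FejerBound.of_forall_gt {M : ℝ} {D : DirSeries X} (h : ∀ M', M < M' → FejerBound M' D) :
    FejerBound M D := fun B N hN ω => by
  have hlim : Tendsto (fun M' : ℝ => M' * B.card) (𝓝[>] M) (𝓝 (M * B.card)) :=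
    ((continuous_mul_const _).tendsto M).mono_left nhdsWithin_le_nhds
  refine ge_of_tendsto hlim ?_
  filter_upwards [self_mem_nhdsWithin] with M' hM'
  exact h M' hM' B N hN ω

theorem FejerBound.of_translate {M : ℝ} {D : DirSeries X}
    (h : ∀ ε : ℝ, 0 < ε → FejerBound M (D.translate ε)) : FejerBound M D := fun B N hN ω => by
  have hlim : Tendsto (fun ε : ℝ =>
      torusSum (fun n => (shiftCount B n : ℂ) • D.translate (ε : ℂ) n) N ω) (𝓝[>] 0)
      (𝓝 (torusSum (fun n => (shiftCount B n : ℂ) • D n) N ω)) := by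
    refine tendsto_finsetSum _ fun n _ => (Tendsto.const_smul ?_ _).const_smul _
    have hc : Continuous fun ε : ℝ => ((n.succPNat : ℕ+) : ℂ) ^ (-(ε : ℂ)) • D n.succPNat :=
      ((by fun_prop : Continuous fun ε : ℝ => -(ε : ℂ)).const_cpow
        (Or.inl (Nat.cast_ne_zero.2 (PNat.ne_zero _)))).smul continuous_const
    have := hc.tendsto 0
    rw [Complex.ofReal_zero, neg_zero, Complex.cpow_zero, one_smul] at this
    exact this.mono_left nhdsWithin_le_nhds
  refine le_of_tendsto hlim.norm ?_
  filter_upwards [self_mem_nhdsWithin] with ε hε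
  exact h ε hε B N hN ω

theorem FejerBound.translate_of_mem_dirHardyPlus {D : DirSeries X} (hD : D ∈ dirHardyPlus X ∞)
    {ε : ℝ} (hε : 0 < ε) : FejerBound (dirHardyPlusNorm ∞ D).toReal (D.translate ε) := by
  -- The Hardy norm is an infimum, so a representing function is chosen with norm below `M'`; its
  -- uniqueness is not needed.
  refine FejerBound.of_forall_gt fun M' hM' => ?_
  have hlt : dirHardyNorm ∞ (D.translate (ε : ℂ)) < ENNReal.ofReal M' := by
    have hle : dirHardyNorm ∞ (D.translate (ε : ℂ)) ≤ dirHardyPlusNorm ∞ D :=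
      le_iSup₂ (f := fun (ε : ℝ) (_ : 0 < ε) => dirHardyNorm ∞ (D.translate (ε : ℂ))) ε hε
    exact hle.trans_lt ((ENNReal.lt_ofReal_iff_toReal_lt hD.2.ne).2 hM')
  simp only [dirHardyNorm, iInf_lt_iff] at hlt
  obtain ⟨f, hf, hfD, hlt⟩ := hlt
  refine (FejerBound.of_isBohrTransform hf hfD).mono ?_
  rw [← ofReal_norm] at hlt
  exact ((ENNReal.ofReal_lt_ofReal_iff_of_nonneg (norm_nonneg _)).1 hlt).le

/-- The Fejér means of the truncation `T` are those of `E` minus those of a block `G` of the tail.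
`G` is a polynomial bounded by `η`, so `T` has Fejér bound `M + η`; since `T` is a polynomial, this
bounds its sup norm. -/
theorem FejerBound.norm_torusSum_le_add [CompleteSpace X] {M η : ℝ} {E : DirSeries X}
    (h : FejerBound M E) {k : ℕ}
    (hη : ∀ l, k ≤ l → ∀ ω, ‖torusSum E l ω - torusSum E k ω‖ ≤ η) (ω : InfTorus) :
    ‖torusSum E k ω‖ ≤ M + η := by
  set T : DirSeries X := fun n => if n.natPred < k then E n else 0
  have hTk : torusSum T k ω = torusSum E k ω := by
    refine Finset.sum_congr rfl fun n hn => ?_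
    simp [T, Finset.mem_range.1 hn]
  rw [← hTk]
  refine FejerBound.norm_torusSum_le ?_ (fun n hn => if_neg (by simpa using hn)) ω
  intro B N hN υ
  -- The block runs up to `l ≥ N`, so that `E - G` and `T` agree at every index below `N`.
  set l := max N k
  set G : DirSeries X := fun n => if k ≤ n.natPred ∧ n.natPred < l then E n else 0
  have hTp : ∀ n, n < k → T n.succPNat = E n.succPNat := fun n hn => if_pos (by simpa using hn)
  have hTn : ∀ n, ¬n < k → T n.succPNat = 0 := fun n hn => if_neg (by simpa using hn)
  have hGp : ∀ n, k ≤ n ∧ n < l → G n.succPNat = E n.succPNat := fun n hn =>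
    if_pos (by rwa [Nat.natPred_succPNat])
  have hGn : ∀ n, ¬(k ≤ n ∧ n < l) → G n.succPNat = 0 := fun n hn =>
    if_neg (by rwa [Nat.natPred_succPNat])
  have hGb : FejerBound η G := by
    refine FejerBound.of_torusFlow (N₀ := l) (fun n hn => hGn n (by omega)) fun t => ?_
    · refine le_of_eq_of_le ?_ (hη l (le_max_right _ _) (torusFlow t))
      rw [torusSum_sub _ (le_max_right _ _), torusSum]
      congr 1
      refine (Finset.sum_subset_zero_on_sdiff ?_ ?_ ?_).symm
      · intro n hn
        exact Finset.mem_range.2 (Finset.mem_Ico.1 hn).2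
      · intro n hn
        rw [Finset.mem_sdiff, Finset.mem_range, Finset.mem_Ico] at hn
        rw [hGn n (by tauto), smul_zero]
      · intro n hn
        rw [hGp n (Finset.mem_Ico.1 hn)]
  have hsub : torusSum (fun n => (shiftCount B n : ℂ) • T n) N υ
      = torusSum (fun n => (shiftCount B n : ℂ) • E n) N υ
        - torusSum (fun n => (shiftCount B n : ℂ) • G n) N υ := by
    rw [torusSum, torusSum, torusSum, ← Finset.sum_sub_distrib]
    refine Finset.sum_congr rfl fun n hn => ?_
    have hnl : n < l := (Finset.mem_range.1 hn).trans_le (le_max_left _ _)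
    rw [← smul_sub, ← smul_sub]
    congr 2
    by_cases h : n < k
    · rw [hTp n h, hGn n (by omega), sub_zero]
    · rw [hTn n h, hGp n ⟨not_lt.1 h, hnl⟩, sub_self]
  rw [hsub, add_mul]
  exact (norm_sub_le _ _).trans (add_le_add (h B N hN υ) (hGb B N hN υ))

theorem exists_bounded_sum_of_mem_dirHardyPlus [CompleteSpace X] {D : DirSeries X}
    (hD : D ∈ dirHardyPlus X ∞) :
    ∃ F : ℂ → X, (∀ s : ℂ, 0 < s.re → Tendsto (D.partialSum s) atTop (𝓝 (F s))) ∧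
      DifferentiableOn ℂ F {s : ℂ | 0 < s.re} ∧
      ∀ s : ℂ, 0 < s.re → ‖F s‖ ≤ (dirHardyPlusNorm ∞ D).toReal := by
  set M := (dirHardyPlusNorm ∞ D).toReal
  have hFε : ∀ ε : ℝ, 0 < ε → FejerBound M (D.translate ε) := fun ε hε =>
    FejerBound.translate_of_mem_dirHardyPlus hD hε
  -- Fejér means involve finitely many coefficients, so the bound survives `ε → 0` and holds for `D`
  -- itself.
  have hK : KernelBound M D := (FejerBound.of_translate hFε).kernelBound
  have htail := fun (ε : ℝ) (hε : 0 < ε) => hK.exists_tail_bound ENNReal.toReal_nonneg hε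
  have hcauchy : ∀ s : ℂ, 0 < s.re → CauchySeq (D.partialSum s) := by
    intro s hs
    obtain ⟨η, hη, hb⟩ := htail s.re hs
    refine cauchySeq_of_le_tendsto_0' η (fun k l hkl => ?_) hη
    rw [dist_comm, dist_eq_norm, partialSum_eq_torusSum, partialSum_eq_torusSum]
    exact hb _ le_rfl k l hkl _
  set F : ℂ → X := fun s => D.value s
  have hF : ∀ s : ℂ, 0 < s.re → Tendsto (D.partialSum s) atTop (𝓝 (F s)) := fun s hs =>
    tendsto_nhds_limUnder (cauchySeq_tendsto_of_complete (hcauchy s hs))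
  refine ⟨F, hF, ?_, fun s hs => ?_⟩
  · have hloc : TendstoLocallyUniformlyOn (fun N s => D.partialSum s N) F atTop
        {s : ℂ | 0 < s.re} := by
      intro u hu s (hs : 0 < s.re)
      obtain ⟨η, hη, hb⟩ := htail (s.re / 2) (by positivity)
      have hunif : TendstoUniformlyOn (fun N s => D.partialSum s N) F atTop
          {z : ℂ | s.re / 2 ≤ z.re} := by
        rw [Metric.tendstoUniformlyOn_iff]
        intro r hr
        filter_upwards [hη.eventually (gt_mem_nhds hr)] with k hk z hz
        have hz0 : 0 < z.re := lt_of_lt_of_le (by positivity) hz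
        refine lt_of_le_of_lt ?_ hk
        refine le_of_tendsto ((hF z hz0).dist tendsto_const_nhds) ?_
        filter_upwards [eventually_ge_atTop k] with l hl
        rw [dist_eq_norm, partialSum_eq_torusSum, partialSum_eq_torusSum]
        exact hb _ hz k l hl _
      refine ⟨_, mem_nhdsWithin_of_mem_nhds ?_, hunif u hu⟩
      filter_upwards [(isOpen_lt continuous_const Complex.continuous_re).mem_nhds
        (show s.re / 2 < s.re by linarith)] with z hz
      exact le_of_lt hz
    refine hloc.differentiableOn (Eventually.of_forall fun N => ?_)
      (isOpen_lt continuous_const Complex.continuous_re)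
    unfold DirSeries.partialSum
    refine (Differentiable.fun_sum fun n _ => Differentiable.smul_const ?_ _).differentiableOn
    exact differentiable_neg.const_cpow (Or.inl (Nat.cast_ne_zero.2 (PNat.ne_zero _)))
  · obtain ⟨η, hη, hb⟩ := htail s.re hs
    have hlim : Tendsto (fun k => M + η k) atTop (𝓝 M) := by simpa using hη.const_add M
    refine le_of_tendsto_of_tendsto (hF s hs).norm hlim (Eventually.of_forall fun k => ?_)
    simp only [partialSum_eq_torusSum]
    exact (hFε _ hs).norm_torusSum_le_add (fun l hl ω => hb _ le_rfl k l hl ω) _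

/-! ### From the half-plane to the Hardy space -/

theorem torusFourierCoeff_torusSum [CompleteSpace X] (E : DirSeries X) (N : ℕ) (α : ℕ →₀ ℤ) :
    torusFourierCoeff (torusSum E N) α
      = ∑ n ∈ Finset.range N, if intIndex (primeExp n.succPNat) = α then E n.succPNat else 0 := by
  have hint : ∀ n ∈ Finset.range N, Integrable (fun ω : InfTorus =>
      torusMonomial (intIndex (primeExp n.succPNat) - α) ω • E n.succPNat) torusMeasure :=
    fun n _ => (Integrable.of_bound (torusMonomial_continuous _).aestronglyMeasurable 1
      (Eventually.of_forall fun ω => (torusMonomial_norm _ _).le)).smul_const _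
  simp only [torusFourierCoeff, torusSum, Finset.smul_sum, torusChar, smul_smul,
    ← torusMonomial_add, neg_add_eq_sub]
  rw [integral_finsetSum _ hint]
  refine Finset.sum_congr rfl fun n _ => ?_
  rw [integral_smul_const]
  split_ifs with h
  · simp [h, torusMonomial_zero]
  · rw [integral_torusMonomial _ (sub_ne_zero.2 h), zero_smul]

/-- The partial sums are uniformly Cauchy, so their limit is a continuous function on the torus. Its
Fourier coefficients are the limits of those of the polynomials, which are eventually constant. -/
theorem exists_torusHardy_of_tail_bound [CompleteSpace X] {E : DirSeries X} {M : ℝ} (hM : 0 ≤ M)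
    {η : ℕ → ℝ} (hη : Tendsto η atTop (𝓝 0))
    (hb : ∀ k l, k ≤ l → ∀ ω, ‖torusSum E l ω - torusSum E k ω‖ ≤ η k)
    (hs : ∀ k ω, ‖torusSum E k ω‖ ≤ M + η k) :
    ∃ f ∈ torusHardy X ∞, IsBohrTransform f E ∧ ‖f‖ ≤ M := by
  set S : ℕ → C(InfTorus, X) := fun N => ⟨torusSum E N, torusSum_continuous E N⟩
  have hη0 : ∀ k, 0 ≤ η k := fun k => (norm_nonneg _).trans (hb k k le_rfl 1)
  have hcauchy : CauchySeq S := by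
    refine cauchySeq_of_le_tendsto_0' η (fun k l hkl => ?_) hη
    rw [dist_comm, dist_eq_norm]
    exact (ContinuousMap.norm_le _ (hη0 k)).2 fun ω => hb k l hkl ω
  obtain ⟨g, hg⟩ := cauchySeq_tendsto_of_complete hcauchy
  have hgω : ∀ ω, Tendsto (fun N => torusSum E N ω) atTop (𝓝 (g ω)) := fun ω =>
    ((continuous_eval_const ω).tendsto g).comp hg
  have hgM : ∀ ω, ‖g ω‖ ≤ M := fun ω => by
    have hlim : Tendsto (fun k => M + η k) atTop (𝓝 M) := by simpa using hη.const_add M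
    exact le_of_tendsto_of_tendsto (hgω ω).norm hlim (Eventually.of_forall fun k => hs k ω)
  set f : Lp X ∞ torusMeasure := ContinuousMap.toLp ∞ torusMeasure ℂ g
  have hfg : f =ᵐ[torusMeasure] g := ContinuousMap.coeFn_toLp torusMeasure g
  have hcoeff : ∀ α, Tendsto (fun N => torusFourierCoeff (torusSum E N) α) atTop
      (𝓝 (torusFourierCoeff f α)) := by
    intro α
    have hfα : torusFourierCoeff f α = torusFourierCoeff g α := by
      refine integral_congr_ae ?_
      filter_upwards [hfg] with ω h
      rw [h]
    rw [hfα, tendsto_iff_norm_sub_tendsto_zero]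
    refine squeeze_zero (fun _ => norm_nonneg _) (fun N => ?_) hη
    have hint : ∀ φ : C(InfTorus, X),
        Integrable (fun ω => torusMonomial (-α) ω • φ ω) torusMeasure := fun φ =>
      Integrable.of_bound ((torusMonomial_continuous _).smul φ.continuous).aestronglyMeasurable ‖φ‖
        (Eventually.of_forall fun ω => by
          rw [norm_smul, torusMonomial_norm, one_mul]; exact φ.norm_coe_le_norm ω)
    have hsub : torusFourierCoeff (torusSum E N) α - torusFourierCoeff g α
        = ∫ ω, torusMonomial (-α) ω • torusSum E N ω - torusMonomial (-α) ω • g ω ∂torusMeasure :=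
      (integral_sub (hint (S N)) (hint g)).symm
    rw [hsub]
    refine (norm_integral_le_of_norm_le_const (C := η N)
      (Eventually.of_forall fun ω => ?_)).trans_eq (by simp)
    rw [← smul_sub, norm_smul, torusMonomial_norm, one_mul, norm_sub_rev]
    refine le_of_tendsto ((hgω ω).sub_const _).norm ?_
    filter_upwards [eventually_ge_atTop N] with l hl
    exact hb N l hl ω
  refine ⟨f, fun α hα => ?_, fun β => ?_, ?_⟩
  · obtain ⟨k, hk⟩ := hα
    refine tendsto_nhds_unique (hcoeff α) (tendsto_const_nhds.congr fun N => ?_)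
    rw [torusFourierCoeff_torusSum]
    refine (Finset.sum_eq_zero fun n _ => if_neg ?_).symm
    rintro rfl
    rw [intIndex_apply] at hk
    omega
  · refine tendsto_nhds_unique (tendsto_const_nhds.congr' ?_) (hcoeff (intIndex β))
    filter_upwards [eventually_gt_atTop (primePow β).natPred] with N hN
    rw [torusFourierCoeff_torusSum, Finset.sum_eq_single (primePow β).natPred]
    · rw [PNat.succPNat_natPred, primeExp_primePow, if_pos rfl]
    · intro n _ hn
      refine if_neg fun h => hn ?_
      rw [← intIndex_injective h, primePow_primeExp, Nat.natPred_succPNat]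
    · exact fun h => absurd (Finset.mem_range.2 hN) h
  · have := Lp.norm_le_of_ae_bound (f := f) hM (by
      filter_upwards [hfg] with ω h
      rw [h]; exact hgM ω)
    simpa using this

theorem translate_mem_dirHardy_of_bounded [CompleteSpace X] {D : DirSeries X} {F : ℂ → X} {M : ℝ}
    (hD : ∀ s : ℂ, 0 < s.re → Tendsto (D.partialSum s) atTop (𝓝 (F s)))
    (hF : DifferentiableOn ℂ F {s : ℂ | 0 < s.re}) (hM : ∀ s : ℂ, 0 < s.re → ‖F s‖ ≤ M)
    {ε : ℝ} (hε : 0 < ε) :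
    D.translate ε ∈ dirHardy X ∞ ∧ dirHardyNorm ∞ (D.translate (ε : ℂ)) ≤ ENNReal.ofReal M := by
  have hM0 : 0 ≤ M := (norm_nonneg _).trans (hM 1 (by simp))
  obtain ⟨η, hη, hb⟩ := (KernelBound.of_bounded hD hF hM).exists_tail_bound hM0 hε
  -- On the line `Re s = ε` the partial sum differs from `F` by at most `η k`; Kronecker's theorem
  -- extends the resulting bound to the whole torus.
  have hs : ∀ k ω, ‖torusSum (D.translate ε) k ω‖ ≤ M + η k := by
    intro k
    refine norm_torusSum_le_of_torusFlow _ _ fun t => ?_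
    set s : ℂ := ε + t * Complex.I
    have hre : s.re = ε := by simp [s]
    have him : s.im = t := by simp [s]
    have hp : ∀ N, torusSum (D.translate ε) N (torusFlow t) = D.partialSum s N := fun N => by
      rw [partialSum_eq_torusSum, hre, him]
    have hs0 : 0 < s.re := by rwa [hre]
    have hdiff : ‖F s - torusSum (D.translate ε) k (torusFlow t)‖ ≤ η k := by
      refine le_of_tendsto ((hD s hs0).sub_const _).norm ?_
      filter_upwards [eventually_ge_atTop k] with l hl
      rw [← hp]
      exact hb ε le_rfl k l hl _
    have h1 := norm_sub_norm_le (torusSum (D.translate ε) k (torusFlow t)) (F s)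
    rw [norm_sub_rev] at h1
    linarith [hM s hs0]
  obtain ⟨f, hf, hfD, hfM⟩ := exists_torusHardy_of_tail_bound hM0 hη
    (fun k l hkl ω => hb ε le_rfl k l hkl ω) hs
  refine ⟨⟨f, hf, hfD⟩, (dirHardyNorm_le hf hfD).trans ?_⟩
  rw [← ofReal_norm]
  exact ENNReal.ofReal_le_ofReal hfM

theorem dirHardyPlusNorm_le_of_bounded [CompleteSpace X] {D : DirSeries X} {F : ℂ → X} {M : ℝ}
    (hD : ∀ s : ℂ, 0 < s.re → Tendsto (D.partialSum s) atTop (𝓝 (F s)))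
    (hF : DifferentiableOn ℂ F {s : ℂ | 0 < s.re}) (hM : ∀ s : ℂ, 0 < s.re → ‖F s‖ ≤ M) :
    dirHardyPlusNorm ∞ D ≤ ENNReal.ofReal M :=
  iSup₂_le fun _ hε => (translate_mem_dirHardy_of_bounded hD hF hM hε).2

end

theorem mainTheorem9 {X : Type*} [NormedAddCommGroup X] [NormedSpace ℂ X] [CompleteSpace X] :
    dirHardyPlus X ∞ = dirBounded X ∧
      ∀ D ∈ dirBounded X, dirHardyPlusNorm ∞ D = dirBoundedNorm D := by
  have hsub : dirBounded X ≤ dirHardyPlus X ∞ := by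
    rintro D ⟨F, hD, hF, C, hC⟩
    exact ⟨fun ε hε => (translate_mem_dirHardy_of_bounded hD hF hC hε).1,
      (dirHardyPlusNorm_le_of_bounded hD hF hC).trans_lt ENNReal.ofReal_lt_top⟩
  refine ⟨le_antisymm (fun D hD => ?_) hsub, fun D hD => le_antisymm ?_ ?_⟩
  · obtain ⟨F, hF, hF', hM⟩ := exists_bounded_sum_of_mem_dirHardyPlus hD
    exact ⟨F, hF, hF', _, hM⟩
  · obtain ⟨F, hF, hF', C, hC⟩ := hD
    have hv : ∀ s : ℂ, 0 < s.re → D.value s = F s := fun s hs => (hF s hs).limUnder_eq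
    have hfin : dirBoundedNorm D ≠ ∞ := by
      refine ne_top_of_le_ne_top (ENNReal.ofReal_ne_top (r := C)) (iSup₂_le fun s hs => ?_)
      rw [hv s hs, ← ofReal_norm]
      exact ENNReal.ofReal_le_ofReal (hC s hs)
    rw [← ENNReal.ofReal_toReal hfin]
    refine dirHardyPlusNorm_le_of_bounded hF hF' fun s hs => ?_
    rw [← toReal_enorm, ← hv s hs]
    exact ENNReal.toReal_mono hfin (le_iSup₂ (f := fun (s : ℂ) (_ : 0 < s.re) => ‖D.value s‖ₑ) s hs)
  · have hD' := hsub hD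
    obtain ⟨F, hF, -, hM⟩ := exists_bounded_sum_of_mem_dirHardyPlus hD'
    refine iSup₂_le fun s hs => ?_
    rw [show D.value s = F s from (hF s hs).limUnder_eq, ← ofReal_norm,
      ← ENNReal.ofReal_toReal hD'.2.ne]
    exact ENNReal.ofReal_le_ofReal (hM s hs)
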